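/- Let $n\ge 1$, let $M$ be a smooth manifold, $\omega\in\Omega^{n+1}(M)$ a closed form, and let $G$ be a Lie group with Lie algebra $\mathfrak g$ acting smoothly on $M$ and preserving $\omega$. For $x\in\mathfrak g$ let $v_x$ be the infinitesimal generator $v_x(p)=\frac{d}{dt}\big|_{t=0}\exp(-tx)\cdot p$, and write $\iota(v_1\wedge\dots\wedge v_k)=\iota_{v_k}\cdots\iota_{v_1}$. Let $\mathcal C$ be the total complex of $\wedge^{\ge 1}\mathfrak g^*\otimes\Omega(M)$, whose differential on $\wedge^k\mathfrak g^*\otimes\Omega(M)$ is $d_{tot}=d_{\mathfrak g}+(-1)^k d$, where $d$ is the de Rham differential and $(d_{\mathfrak g}\varphi)(x_1,\dots,x_{k+1})=\sum_{i<j}(-1)^{i+j}\varphi([x_i,x_j],x_1,\dots,\widehat{x_i},\dots,\widehat{x_j},\dots,x_{k+1})$ is the Chevalley–Eilenberg differential. Put $$\widetilde\omega=\sum_{k=1}^{n+1}(-1)^{k-1}\omega_k,\qquad \omega_k(x_1,\dots,x_k)=\iota(v_{x_1}\wedge\dots\wedge v_{x_k})\omega,\qquad \varsigma(k)=-(-1)^{k(k+1)/2}.$$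 A homotopy moment map for the action is an $L_\infty$-morphism $f$ from $\mathfrak g$ to the $L_\infty$-algebra $L_\infty(M,\omega)$ of observables (whose degree $0$ part consists of the Hamiltonian forms, i.e. the $\alpha\in\Omega^{n-1}(M)$ with $d\alpha=-\iota_v\omega$ for some vector field $v$) such that $d(f_1(x))=-\iota(v_x)\omega$ for all $x\in\mathfrak g$; explicitly, it consists of linear maps $f_k\colon\wedge^k\mathfrak g\to\Omega^{n-k}(M)$, $k=1,\dots,n$, with $f_1$ taking values in Hamiltonian forms and satisfying $d(f_1(x))=-\iota(v_x)\omega$, such that $$\sum_{1\le i<j\le k}(-1)^{i+j+1}f_{k-1}([x_i,x_j],x_1,\dots,\widehat{x_i},\dots,\widehat{x_j},\dots,x_k)=d f_k(x_1,\dots,x_k)+\varsigma(k)\,\iota(v_{x_1}\wedge\dots\wedge v_{x_k})\omega$$ for $2\le k\le n$ and all $x_i\in\mathfrak g$, and such that the same identity holds for $k=n+1$ without the term $df_{n+1}$. Then $d_{tot}\widetilde\omega=0$. An element $\varphi=\varphi_1+\dots+\varphi_n$ with $\varphi_k\in\wedge^k\mathfrak g^*\otimes\Omega^{n-k}(M)$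 satisfies $d_{tot}\varphi=\widetilde\omega$ if and only if the maps $f_k=\varsigma(k)\varphi_k$, $k=1,\dots,n$, are the components of a homotopy moment map for the action of $G$ on $(M,\omega)$. Consequently $\varphi\mapsto(\varsigma(k)\varphi_k)_k$ is a bijection from the primitives of the cocycle $\widetilde\omega$ onto the homotopy moment maps; both sets are (possibly empty) affine subspaces, corresponding to each other under this linear map, and the space of primitives, if non-empty, has as its direction the space of $d_{tot}$-closed elements of total degree $n$. -/

import Mathlib

open scoped Manifold ContDiff Topology
open Bundle

namespace HomotopyMoment
noncomputable section
section Forms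
variable (E : Type*) [NormedAddCommGroup E] [NormedSpace ℝ E]
variable (M : Type*) [TopologicalSpace M] [ChartedSpace E M]

/-- Not necessarily smooth `k`-forms on `M`: families of alternating forms on the tangent spaces. -/
abbrev RoughForm (k : ℕ) : Type _ := ∀ p : M, TangentSpace 𝓘(ℝ, E) p [⋀^Fin k]→L[ℝ] ℝ

variable {E M}
/-- The form `σ` written in the preferred chart `φ` at `x`, i.e. the pullback of `σ` along `φ⁻¹`. It is
meaningful on the target of `φ`. -/
def localRep {k : ℕ} (σ : RoughForm E M k) (x : M) (y : E) : E [⋀^Fin k]→L[ℝ] ℝ :=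
  (σ ((extChartAt 𝓘(ℝ, E) x).symm y)).compContinuousLinearMap
    (mfderiv 𝓘(ℝ, E) 𝓘(ℝ, E) (extChartAt 𝓘(ℝ, E) x).symm y)

/-- A form is smooth if all its coordinate expressions are smooth. -/
def IsSmoothForm {k : ℕ} (σ : RoughForm E M k) : Prop :=
  ∀ x : M, ContDiffOn ℝ ∞ (localRep σ x) (extChartAt 𝓘(ℝ, E) x).target

lemma localRep_add {k : ℕ} (σ η : RoughForm E M k) (x : M) :
    localRep (σ + η) x = localRep σ x + localRep η x := rfl
lemma localRep_smul {k : ℕ} (c : ℝ) (σ : RoughForm E M k) (x : M) :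
    localRep (c • σ) x = c • localRep σ x := rfl
lemma localRep_zero {k : ℕ} (x : M) :
    localRep (0 : RoughForm E M k) x = 0 := rfl

variable (E M) in
/-- The real vector space of smooth `k`-forms on `M`. -/
def smoothForms (k : ℕ) : Submodule ℝ (RoughForm E M k) where
  carrier := {σ | IsSmoothForm σ}
  add_mem' {a b} ha hb x := by rw [localRep_add]; exact (ha x).add (hb x)
  zero_mem' x := by rw [localRep_zero]; exact contDiffOn_const (c := 0)
  smul_mem' c a ha x := by rw [localRep_smul]; exact contDiffOn_const.smul (ha x)

/-- The exterior derivative: at `p`, take the coordinate expression in the chart `φ` at `p`, apply the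
exterior derivative of the model vector space, and pull the result back along `φ`.
It agrees with the exterior derivative computed in any other chart, see `localRep_roughExtDeriv`. -/
def roughExtDeriv {k : ℕ} (σ : RoughForm E M k) : RoughForm E M (k + 1) := fun p =>
  (extDeriv (localRep σ p) (extChartAt 𝓘(ℝ, E) p p)).compContinuousLinearMap
    (mfderiv 𝓘(ℝ, E) 𝓘(ℝ, E) (extChartAt 𝓘(ℝ, E) p) p)

variable (E M) in
/-- `Ω^k(M)`. -/
def DiffForm (k : ℕ) : Type _ := smoothForms E M k

instance (k : ℕ) : AddCommGroup (DiffForm E M k) :=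
  inferInstanceAs (AddCommGroup (smoothForms E M k))

instance (k : ℕ) : Module ℝ (DiffForm E M k) := inferInstanceAs (Module ℝ (smoothForms E M k))

lemma roughExtDeriv_add {k : ℕ} {σ η : RoughForm E M k} (hσ : IsSmoothForm σ)
    (hη : IsSmoothForm η) :
    roughExtDeriv (σ + η) = roughExtDeriv σ + roughExtDeriv η := by
  funext p
  have h : ∀ {τ : RoughForm E M k}, IsSmoothForm τ →
      DifferentiableAt ℝ (localRep τ p) (extChartAt 𝓘(ℝ, E) p p) := fun h =>
    ((h p).contDiffAt (extChartAt_target_mem_nhds p)).differentiableAt (by simp)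
  simp only [HomotopyMoment.roughExtDeriv, localRep_add, extDeriv_add (h hσ) (h hη)]
  rfl

lemma roughExtDeriv_smul {k : ℕ} (c : ℝ) (σ : RoughForm E M k) :
    roughExtDeriv (c • σ) = c • roughExtDeriv σ := by
  funext p
  simp only [HomotopyMoment.roughExtDeriv, localRep_smul, extDeriv_smul]
  rfl

lemma diffForm_ext {N : ℕ} {σ τ : DiffForm E M N}
    (h : ∀ (p : M) (w : Fin N → TangentSpace 𝓘(ℝ, E) p), σ.1 p w = τ.1 p w) : σ = τ :=
  Subtype.ext (funext fun p => ContinuousAlternatingMap.ext (h p))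

variable [IsManifold 𝓘(ℝ, E) ∞ M]
variable (E M) in
/-- Smooth vector fields on `M`. -/
abbrev VecField : Type _ := Cₛ^∞⟮𝓘(ℝ, E); E, (TangentSpace 𝓘(ℝ, E) : M → Type _)⟯

lemma mdifferentiableAt_chart_symm (x : M) {y : E} (hy : y ∈ (extChartAt 𝓘(ℝ, E) x).target) :
    MDifferentiableAt 𝓘(ℝ, E) 𝓘(ℝ, E) (extChartAt 𝓘(ℝ, E) x).symm y := by
  have h := mdifferentiableWithinAt_extChartAt_symm (I := 𝓘(ℝ, E)) hy
  rwa [ModelWithCorners.range_eq_univ, mdifferentiableWithinAt_univ] at h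

lemma contDiffAt_coordChange (x z : M) {y : E}
    (hy : y ∈ (extChartAt 𝓘(ℝ, E) x).target)
    (hz : (extChartAt 𝓘(ℝ, E) x).symm y ∈ (extChartAt 𝓘(ℝ, E) z).source) :
    ContDiffAt ℝ ∞ (extChartAt 𝓘(ℝ, E) z ∘ (extChartAt 𝓘(ℝ, E) x).symm) y := by
  have h := contDiffWithinAt_ext_coord_change (I := 𝓘(ℝ, E)) (n := ∞) z x (y := y)
    (by
      rw [PartialEquiv.trans_source, PartialEquiv.symm_source]
      exact ⟨hy, hz⟩)
  rwa [ModelWithCorners.range_eq_univ, contDiffWithinAt_univ] at h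

lemma mdifferentiableAt_chart (z : M) {p : M} (hp : p ∈ (extChartAt 𝓘(ℝ, E) z).source) :
    MDifferentiableAt 𝓘(ℝ, E) 𝓘(ℝ, E) (extChartAt 𝓘(ℝ, E) z) p :=
  mdifferentiableAt_extChartAt (by rwa [extChartAt_source] at hp)

lemma mfderiv_chart_comp (x z : M) {y : E} (hy : y ∈ (extChartAt 𝓘(ℝ, E) x).target)
    (hz : (extChartAt 𝓘(ℝ, E) x).symm y ∈ (extChartAt 𝓘(ℝ, E) z).source) :
    (mfderiv 𝓘(ℝ, E) 𝓘(ℝ, E) (extChartAt 𝓘(ℝ, E) z) ((extChartAt 𝓘(ℝ, E) x).symm y)) ∘L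
      (mfderiv 𝓘(ℝ, E) 𝓘(ℝ, E) (extChartAt 𝓘(ℝ, E) x).symm y) =
    fderiv ℝ (extChartAt 𝓘(ℝ, E) z ∘ (extChartAt 𝓘(ℝ, E) x).symm) y := by
  rw [← mfderiv_eq_fderiv]
  exact (mfderiv_comp y (mdifferentiableAt_chart z hz) (mdifferentiableAt_chart_symm x hy)).symm

lemma localRep_coordChange {k : ℕ} (σ : RoughForm E M k) (x z : M) {y : E}
    (hy : y ∈ (extChartAt 𝓘(ℝ, E) x).target)
    (hz : (extChartAt 𝓘(ℝ, E) x).symm y ∈ (extChartAt 𝓘(ℝ, E) z).source) :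
    localRep σ x y =
      (localRep σ z ((extChartAt 𝓘(ℝ, E) z ∘ (extChartAt 𝓘(ℝ, E) x).symm) y)).compContinuousLinearMap
        (fderiv ℝ (extChartAt 𝓘(ℝ, E) z ∘ (extChartAt 𝓘(ℝ, E) x).symm) y) := by
  have key : ∀ (p q : M) (_ : p = q) (A : E →L[ℝ] TangentSpace 𝓘(ℝ, E) p)
      (B : E →L[ℝ] TangentSpace 𝓘(ℝ, E) q) (T : E →L[ℝ] E),
      (∀ v, (A v : E) = (B (T v) : E)) →
      (σ p).compContinuousLinearMap A = ((σ q).compContinuousLinearMap B).compContinuousLinearMap T := by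
    rintro p q rfl A B T h
    ext v
    simp only [ContinuousAlternatingMap.compContinuousLinearMap_apply]
    congr 1
    funext i
    exact h (v i)
  have hsrc := (extChartAt 𝓘(ℝ, E) z).left_inv hz
  refine key _ _ hsrc.symm _ _ _ fun v => ?_
  rw [← mfderiv_chart_comp x z hy hz]
  have hid := mfderivWithin_extChartAt_symm_comp_mfderiv_extChartAt' (I := 𝓘(ℝ, E)) hz
  rw [ModelWithCorners.range_eq_univ, mfderivWithin_univ] at hid
  exact (DFunLike.congr_fun hid (mfderiv 𝓘(ℝ, E) 𝓘(ℝ, E) (extChartAt 𝓘(ℝ, E) x).symm y v)).symm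

lemma localRep_roughExtDeriv {k : ℕ} {σ : RoughForm E M k} (hσ : IsSmoothForm σ) (x : M) {y : E}
   (hy : y ∈ (extChartAt 𝓘(ℝ, E) x).target) :
   localRep (roughExtDeriv σ) x y = extDeriv (localRep σ x) y := by
  set p := (extChartAt 𝓘(ℝ, E) x).symm y with hp
  have hopen : IsOpen ((extChartAt 𝓘(ℝ, E) x).target ∩
      (extChartAt 𝓘(ℝ, E) x).symm ⁻¹' (extChartAt 𝓘(ℝ, E) p).source) :=
    (continuousOn_extChartAt_symm x).isOpen_inter_preimage (isOpen_extChartAt_target x)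
      (isOpen_extChartAt_source p)
  have hz : (extChartAt 𝓘(ℝ, E) x).symm y ∈ (extChartAt 𝓘(ℝ, E) p).source :=
    mem_extChartAt_source p
  have hev : localRep σ x =ᶠ[𝓝 y] fun y =>
      (localRep σ p ((extChartAt 𝓘(ℝ, E) p ∘ (extChartAt 𝓘(ℝ, E) x).symm) y)).compContinuousLinearMap
        (fderiv ℝ (extChartAt 𝓘(ℝ, E) p ∘ (extChartAt 𝓘(ℝ, E) x).symm) y) := by
    filter_upwards [hopen.mem_nhds ⟨hy, hz⟩] with u hu
    exact localRep_coordChange σ x p hu.1 hu.2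
  rw [hev.extDeriv_eq, extDeriv_pullback (r := ∞)
    (f := extChartAt 𝓘(ℝ, E) p ∘ (extChartAt 𝓘(ℝ, E) x).symm)
    (((hσ p).contDiffAt ((isOpen_extChartAt_target p).mem_nhds
      ((extChartAt 𝓘(ℝ, E) p).map_source hz))).differentiableAt (by simp))
    (contDiffAt_coordChange x p hy hz) (by simpa using! (ENat.LEInfty.out (m := 2))), ← mfderiv_chart_comp x p hy hz]
  rfl

lemma IsSmoothForm.roughExtDeriv {k : ℕ} {σ : RoughForm E M k} (hσ : IsSmoothForm σ) :
    IsSmoothForm (roughExtDeriv σ) := fun x => by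
  have hop := isOpen_extChartAt_target (I := 𝓘(ℝ, E)) x
  refine ContDiffOn.congr (f := extDeriv (localRep σ x)) ?_ fun y hy =>
    localRep_roughExtDeriv hσ x hy
  exact (ContinuousAlternatingMap.alternatizeUncurryFinCLM ℝ E ℝ).contDiff.comp_contDiffOn
    (((contDiffOn_infty_iff_fderiv_of_isOpen hop).1 (hσ x)).2)

/-- The de Rham differential `d : Ω^k(M) → Ω^{k+1}(M)`. -/
def extD (k : ℕ) : DiffForm E M k →ₗ[ℝ] DiffForm E M (k + 1) where
  toFun σ := ⟨roughExtDeriv σ.1, σ.2.roughExtDeriv⟩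
  map_add' σ η := Subtype.ext (roughExtDeriv_add σ.2 η.2)
  map_smul' c σ := Subtype.ext (roughExtDeriv_smul c σ.1)

/-- Contraction of a form with a vector field in the first argument. -/
def roughInterior {k : ℕ} (V : ∀ p : M, TangentSpace 𝓘(ℝ, E) p) (σ : RoughForm E M (k + 1)) :
    RoughForm E M k := fun p => ContinuousAlternatingMap.curryLeft (E := E) (σ p) (V p)

lemma contDiffOn_vecField (V : VecField E M) (x : M) :
    ContDiffOn ℝ ∞ (fun y : E => (mfderiv 𝓘(ℝ, E) 𝓘(ℝ, E) (extChartAt 𝓘(ℝ, E) x)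
      ((extChartAt 𝓘(ℝ, E) x).symm y) (V ((extChartAt 𝓘(ℝ, E) x).symm y)) : E))
      (extChartAt 𝓘(ℝ, E) x).target := by
  have h1 : ContMDiffOn 𝓘(ℝ, E) 𝓘(ℝ, E) ∞ (extChartAt 𝓘(ℝ, E) x).symm
      (extChartAt 𝓘(ℝ, E) x).target := contMDiffOn_extChartAt_symm x
  have h2 := V.contMDiff.comp_contMDiffOn h1
  have hsrc : ∀ y ∈ (extChartAt 𝓘(ℝ, E) x).target,
      (extChartAt 𝓘(ℝ, E) x).symm y ∈ (chartAt E x).source := fun y hy => by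
    rw [← extChartAt_source 𝓘(ℝ, E)]; exact (extChartAt 𝓘(ℝ, E) x).map_target hy
  have h3 := ((trivializationAt E (TangentSpace 𝓘(ℝ, E)) x).contMDiffOn_iff (fun y hy => by
    rw [Trivialization.mem_source]
    exact hsrc y hy)).1 h2
  refine (contMDiffOn_iff_contDiffOn.1 h3.2).congr fun y hy => ?_
  rw [← TangentBundle.continuousLinearMapAt_trivializationAt (hsrc y hy)]
  exact Trivialization.continuousLinearMapAt_apply_of_mem ℝ
    (trivializationAt E (TangentSpace 𝓘(ℝ, E)) x) (hsrc y hy) _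

lemma IsSmoothForm.interior {k : ℕ} {σ : RoughForm E M (k + 1)} (hσ : IsSmoothForm σ)
    (V : VecField E M) : IsSmoothForm (roughInterior (fun p => V p) σ) := fun x => by
  refine ContDiffOn.congr (f := fun y => (localRep σ x y).curryLeft
    (mfderiv 𝓘(ℝ, E) 𝓘(ℝ, E) (extChartAt 𝓘(ℝ, E) x)
      ((extChartAt 𝓘(ℝ, E) x).symm y) (V ((extChartAt 𝓘(ℝ, E) x).symm y)) : E)) ?_ fun y hy => ?_
  · exact ((ContinuousAlternatingMap.curryLeftLI (𝕜 := ℝ) (E := E) (F := ℝ)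
      (n := k)).toContinuousLinearMap.contDiff.comp_contDiffOn (hσ x)).clm_apply
      (contDiffOn_vecField V x)
  · have hid := mfderivWithin_extChartAt_symm_comp_mfderiv_extChartAt (I := 𝓘(ℝ, E)) hy
    rw [ModelWithCorners.range_eq_univ, mfderivWithin_univ] at hid
    have hid' := DFunLike.congr_fun hid (V ((extChartAt 𝓘(ℝ, E) x).symm y))
    ext v
    change σ _ _ = σ _ _
    congr 1
    funext i
    refine Fin.cases ?_ (fun i => ?_) i
    · exact hid'.symm
    · rfl

/-- The interior product `ι_V : Ω^{k+1}(M) → Ω^k(M)`. -/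
def interiorProd (k : ℕ) : VecField E M →ₗ[ℝ] DiffForm E M (k + 1) →ₗ[ℝ] DiffForm E M k :=
  LinearMap.mk₂ ℝ (fun V σ => ⟨roughInterior (fun p => V p) σ.1, σ.2.interior V⟩)
    (fun V W σ => Subtype.ext (funext fun p =>
      (ContinuousAlternatingMap.curryLeft (E := E) (σ.1 p)).map_add (V p) (W p)))
    (fun c V σ => Subtype.ext (funext fun p =>
      (ContinuousAlternatingMap.curryLeft (E := E) (σ.1 p)).map_smul c (V p)))
    (fun _ _ _ => rfl) (fun _ _ _ => rfl)

/-- `ι_{V_{k-1}} ⋯ ι_{V_0} σ`, that is, `σ(V_0, …, V_{k-1}, ·)`. -/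
def contractAux (l : ℕ) : (k : ℕ) → (Fin k → VecField E M) →
    DiffForm E M (l + k) → DiffForm E M l
  | 0, _, σ => σ
  | k + 1, V, σ => contractAux l k (Fin.tail V) (interiorProd (l + k) (V 0) σ)

/-- The contraction `ι(V_1 ∧ ⋯ ∧ V_k) σ = ι_{V_k} ⋯ ι_{V_1} σ` of an `N`-form, where `N = l + k`;
see `contract_apply` for its values. -/
def contract {k l N : ℕ} (h : l + k = N) (V : Fin k → VecField E M) (σ : DiffForm E M N) :
    DiffForm E M l :=
  contractAux l k V (h ▸ σ)

lemma cons_append_tail {X : Type*} (l k : ℕ) (V : Fin (k + 1) → X) (w : Fin l → X) :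
    (Fin.cons (V 0) (Fin.append (Fin.tail V) w ∘ Fin.cast (Nat.add_comm l k)) :
      Fin (l + k + 1) → X) = Fin.append V w ∘ Fin.cast (Nat.add_comm l (k + 1)) := by
  funext i
  refine Fin.cases ?_ (fun i => ?_) i
  · have : Fin.cast (Nat.add_comm l (k + 1)) 0 = Fin.castAdd l (0 : Fin (k + 1)) := by ext; simp
    rw [Function.comp_apply, this, Fin.append_left, Fin.cons_zero]
  · obtain ⟨j, rfl⟩ : ∃ j, i = Fin.cast (Nat.add_comm k l) j :=
      ⟨Fin.cast (Nat.add_comm l k) i, rfl⟩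
    rw [Fin.cons_succ, Function.comp_apply, Function.comp_apply]
    refine Fin.addCases (fun a => ?_) (fun a => ?_) j
    · have : Fin.cast (Nat.add_comm l (k + 1))
          (Fin.cast (Nat.add_comm k l) (Fin.castAdd l a)).succ = Fin.castAdd l a.succ := by
        ext; simp
      rw [this, Fin.append_left]
      exact Fin.append_left _ _ a
    · have : Fin.cast (Nat.add_comm l (k + 1))
          (Fin.cast (Nat.add_comm k l) (Fin.natAdd k a)).succ = Fin.natAdd (k + 1) a := by
        ext; simp; omega
      rw [this, Fin.append_right]
      exact Fin.append_right _ _ a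

lemma contractAux_apply (l k : ℕ) (V : Fin k → VecField E M) (σ : DiffForm E M (l + k))
    (p : M) (w : Fin l → TangentSpace 𝓘(ℝ, E) p) :
    (contractAux l k V σ).1 p w =
      σ.1 p (Fin.append (fun i => V i p) w ∘ Fin.cast (Nat.add_comm l k)) := by
  induction k with
  | zero =>
    change σ.1 p w = _
    congr 1
    funext i
    have : Fin.cast (Nat.add_comm l 0) i = Fin.natAdd 0 i := by ext; simp
    simp only [Function.comp_apply, this, Fin.append_right]
  | succ k ih =>
    change (contractAux l k (Fin.tail V) (interiorProd (l + k) (V 0) σ)).1 p w = _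
    rw [ih]
    exact congrArg (σ.1 p) (cons_append_tail l k (fun i => V i p) w)

lemma contract_apply {k l N : ℕ} (h : l + k = N) (V : Fin k → VecField E M) (σ : DiffForm E M N)
    (p : M) (w : Fin l → TangentSpace 𝓘(ℝ, E) p) :
    (contract h V σ).1 p w =
      σ.1 p (Fin.append (fun i => V i p) w ∘ Fin.cast (h.symm.trans (Nat.add_comm l k))) := by
  subst h
  exact contractAux_apply l k V σ p w

end Forms

section Action
variable {E : Type*} [NormedAddCommGroup E] [NormedSpace ℝ E]
variable {M : Type*} [TopologicalSpace M] [ChartedSpace E M] [IsManifold 𝓘(ℝ, E) ∞ M]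
variable {F : Type*} [NormedAddCommGroup F] [NormedSpace ℝ F]
variable {G : Type*} [TopologicalSpace G] [ChartedSpace F G] [Group G] [LieGroup 𝓘(ℝ, F) ∞ G]
variable [MulAction G M] [ContMDiffSMul 𝓘(ℝ, F) 𝓘(ℝ, E) ∞ G M]

lemma contMDiff_orbitDeriv (x : GroupLieAlgebra 𝓘(ℝ, F) G) :
    ContMDiff 𝓘(ℝ, E) (𝓘(ℝ, E).prod 𝓘(ℝ, E)) ∞ (fun p : M => (TotalSpace.mk' E p
      (mfderiv 𝓘(ℝ, F) 𝓘(ℝ, E) (fun g : G => g • p) 1 x : TangentSpace 𝓘(ℝ, E) p) :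
        TangentBundle 𝓘(ℝ, E) M)) := by
  have hs : ContMDiff (𝓘(ℝ, F).prod 𝓘(ℝ, E)) 𝓘(ℝ, E) ∞ (fun q : G × M => q.1 • q.2) :=
    ContMDiffSMul.contMDiff_smul
  let fp : M → TangentBundle 𝓘(ℝ, E) M := fun p => TotalSpace.mk' E p 0
  have sfp : ContMDiff 𝓘(ℝ, E) (𝓘(ℝ, E).prod 𝓘(ℝ, E)) ∞ fp := contMDiff_zeroSection _ _
  let fx : M → TangentBundle 𝓘(ℝ, F) G := fun _ => TotalSpace.mk' F 1 x
  have sfx : ContMDiff 𝓘(ℝ, E) (𝓘(ℝ, F).prod 𝓘(ℝ, F)) ∞ fx := contMDiff_const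
  have S₁ := sfx.prodMk sfp
  have S₂ : ContMDiff _ _ ∞ (equivTangentBundleProd 𝓘(ℝ, F) G 𝓘(ℝ, E) M).symm :=
    contMDiff_equivTangentBundleProd_symm
  have S₃ := hs.contMDiff_tangentMap (m := ∞) (by simp)
  have S := ((S₃.comp S₂).comp S₁)
  have aux : ∀ (p q : M) (_ : q = p) (a b : E), a = b →
      (TotalSpace.mk' E p (a : TangentSpace 𝓘(ℝ, E) p) : TangentBundle 𝓘(ℝ, E) M) =
        TotalSpace.mk' E q (b : TangentSpace 𝓘(ℝ, E) q) := by
    rintro p q rfl a b rfl; rfl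
  refine S.congr fun p => aux p ((1 : G) • p) (one_smul G p) _ _ ?_
  have hd := mfderiv_prod_eq_add_apply (I := 𝓘(ℝ, F)) (I' := 𝓘(ℝ, E)) (I'' := 𝓘(ℝ, E))
    (f := fun q : G × M => q.1 • q.2) (p := ((1 : G), p)) (v := ((x, 0) : F × E))
    ((hs _).mdifferentiableAt (by simp))
  refine Eq.trans ?_ hd.symm
  exact ((congrArg _ (map_zero (mfderiv 𝓘(ℝ, E) 𝓘(ℝ, E) (fun z : M => (1 : G) • z) p))).trans
    (add_zero _)).symm

variable (E M) in
/-- The infinitesimal generators `x ↦ v_x` of the action: `v_x(p)` is the derivative at `t = 0` of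
`exp(-t x) • p`, i.e. minus the derivative at `1` of the orbit map `g ↦ g • p` in direction `x`.
With this sign, `x ↦ v_x` is compatible with Lie brackets. -/
def generator : GroupLieAlgebra 𝓘(ℝ, F) G →ₗ[ℝ] VecField E M where
  toFun x := -⟨fun p => mfderiv 𝓘(ℝ, F) 𝓘(ℝ, E) (fun g : G => g • p) 1 x, contMDiff_orbitDeriv x⟩
  map_add' x y := by
    refine ContMDiffSection.ext fun p => ?_
    have h := map_add (mfderiv 𝓘(ℝ, F) 𝓘(ℝ, E) (fun g : G => g • p) 1) x y
    exact (congrArg Neg.neg h).trans (neg_add _ _)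
  map_smul' c x := by
    refine ContMDiffSection.ext fun p => ?_
    have h := map_smul (mfderiv 𝓘(ℝ, F) 𝓘(ℝ, E) (fun g : G => g • p) 1) c x
    exact (congrArg Neg.neg h).trans (smul_neg _ _).symm

instance : LieGroup 𝓘(ℝ, F) (minSmoothness ℝ 3) G := by
  rw [minSmoothness_of_isRCLikeNormedField]; infer_instance

variable (G) in
/-- `G` preserves `σ`: every `g` pulls `σ` back to itself. -/
def IsInvariant {N : ℕ} (σ : DiffForm E M N) : Prop :=
  ∀ (g : G) (p : M), (σ.1 (g • p)).compContinuousLinearMap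
    (mfderiv 𝓘(ℝ, E) 𝓘(ℝ, E) (fun q : M => g • q) p) = σ.1 p

lemma append_update {X : Type*} {k l N : ℕ} (h : N = k + l) (i : Fin k) (V : Fin k → X)
    (w : Fin l → X) (a : X) :
    Fin.append (Function.update V i a) w ∘ Fin.cast h =
      Function.update (Fin.append V w ∘ Fin.cast h) (Fin.cast h.symm (Fin.castAdd l i)) a := by
  subst h
  funext j
  refine Fin.addCases (fun b => ?_) (fun b => ?_) j
  · by_cases hb : b = i
    · subst hb; simp
    · have : Fin.castAdd l b ≠ Fin.castAdd l i := fun hh => hb (Fin.castAdd_injective _ _ hh)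
      simp [hb]
  · have : Fin.natAdd k b ≠ Fin.castAdd l i := fun hh => by
      have := congrArg Fin.val hh; simp at this; omega
    simp [this]

lemma generator_update {k : ℕ} (x : Fin k → GroupLieAlgebra 𝓘(ℝ, F) G) (i : Fin k)
    (a : GroupLieAlgebra 𝓘(ℝ, F) G) (p : M) :
    (fun j => (generator E M (Function.update x i a j) p : TangentSpace 𝓘(ℝ, E) p)) =
      Function.update (fun j => generator E M (x j) p) i (generator E M a p) := by
  funext j
  by_cases hj : j = i
  · subst hj; simp
  · simp [hj]

variable (F G) in
/-- `(x_1, …, x_k) ↦ ι(v_{x_1} ∧ ⋯ ∧ v_{x_k}) σ`, an element of `Λ^k 𝔤* ⊗ Ω^l(M)`. -/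
def contractGen {k l N : ℕ} (h : l + k = N) (σ : DiffForm E M N) :
    GroupLieAlgebra 𝓘(ℝ, F) G [⋀^Fin k]→ₗ[ℝ] DiffForm E M l where
  toFun x := contract h (fun i => generator E M (x i)) σ
  map_update_add' := fun {dec} x i a b => by
    rw [Subsingleton.elim dec (instDecidableEqFin k)]
    refine diffForm_ext fun p w => ?_
    refine Eq.trans ?_ (ContinuousAlternatingMap.add_apply _ _ w).symm
    rw [contract_apply, contract_apply, contract_apply]
    simp only [generator_update, append_update, map_add]
    exact (σ.1 p).map_update_add _ _ _ _
  map_update_smul' := fun {dec} x i c a => by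
    rw [Subsingleton.elim dec (instDecidableEqFin k)]
    refine diffForm_ext fun p w => ?_
    refine Eq.trans ?_ (ContinuousAlternatingMap.smul_apply _ c w).symm
    rw [contract_apply, contract_apply]
    simp only [generator_update, append_update, map_smul]
    exact (σ.1 p).map_update_smul _ _ _ _
  map_eq_zero_of_eq' x i j hx hij := by
    refine diffForm_ext fun p w => ?_
    rw [contract_apply]
    refine (σ.1 p).map_eq_zero_of_eq _
      (i := Fin.cast (h.symm.trans (Nat.add_comm l k)).symm (Fin.castAdd l i))
      (j := Fin.cast (h.symm.trans (Nat.add_comm l k)).symm (Fin.castAdd l j)) ?_ ?_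
    · simp only [Function.comp_apply, Fin.cast_cast, Fin.cast_eq_self, Fin.append_left, hx]
    · intro hh
      apply hij
      have := congrArg Fin.val hh
      exact Fin.ext (by simpa using this)

end Action

section ChevalleyEilenberg
variable {L : Type*} [LieRing L] [LieAlgebra ℝ L] {W : Type*} [AddCommGroup W] [Module ℝ W]

lemma ceSum_eq {k : ℕ} (φ : L [⋀^Fin (k + 1)]→ₗ[ℝ] W) (x : Fin (k + 2) → L) :
    ∑ i : Fin (k + 1), ∑ j ≥ i, (-1 : ℝ) ^ ((i : ℕ) + j + 1) •
      φ (Matrix.vecCons ⁅x i.castSucc, x j.succ⁆ (j.removeNth (i.castSucc.removeNth x))) =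
    (-(1 / 2 : ℝ)) • AlternatingMap.alternatizeUncurryFin (AlternatingMap.alternatizeUncurryFinLM ∘ₗ
      ((LieModule.toEnd ℝ L L : L →ₗ[ℝ] L →ₗ[ℝ] L).compr₂ φ.curryLeft)) x := by
  rw [AlternatingMap.alternatizeUncurryFin_alternatizeUncurryFinLM_comp_apply, Finset.smul_sum]
  refine Finset.sum_congr rfl fun i _ => ?_
  rw [Finset.smul_sum]
  refine Finset.sum_congr rfl fun j _ => ?_
  have hskew : φ (Matrix.vecCons ⁅x j.succ, x i.castSucc⁆
      (j.removeNth (i.castSucc.removeNth x))) =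
      -φ (Matrix.vecCons ⁅x i.castSucc, x j.succ⁆ (j.removeNth (i.castSucc.removeNth x))) := by
    rw [← lie_skew]
    exact DFunLike.congr_fun (map_neg φ.curryLeft ⁅x i.castSucc, x j.succ⁆)
      (j.removeNth (i.castSucc.removeNth x))
  change _ = -(1 / 2 : ℝ) • (-1 : ℤ) ^ ((i : ℕ) + j) •
    (φ (Matrix.vecCons ⁅x i.castSucc, x j.succ⁆ (j.removeNth (i.castSucc.removeNth x))) -
      φ (Matrix.vecCons ⁅x j.succ, x i.castSucc⁆ (j.removeNth (i.castSucc.removeNth x))))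
  rw [hskew]
  generalize φ (Matrix.vecCons ⁅x i.castSucc, x j.succ⁆
    (j.removeNth (i.castSucc.removeNth x))) = u
  rw [← Int.cast_smul_eq_zsmul ℝ]
  push_cast
  module

/-- The Chevalley–Eilenberg differential of cochains with values in a vector space `W` (with
trivial action),
`(d φ)(x_1, …, x_r) = ∑_{a < b} (-1)^{a+b} φ([x_a, x_b], x_1, …, x̂_a, …, x̂_b, …, x_r)`.
The pair `a < b` of `{1, …, r}`, `r = k + 2`, is encoded by `i ≤ j` in `Fin (k + 1)` through
`a = i + 1` and `b = j + 2`; then `x_a = x i.castSucc` and `x_b = x j.succ`. -/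
def ceD (k : ℕ) : (L [⋀^Fin (k + 1)]→ₗ[ℝ] W) →ₗ[ℝ] (L [⋀^Fin (k + 2)]→ₗ[ℝ] W) where
  toFun φ :=
    { toFun := fun x => ∑ i : Fin (k + 1), ∑ j ≥ i, (-1 : ℝ) ^ ((i : ℕ) + j + 1) •
        φ (Matrix.vecCons ⁅x i.castSucc, x j.succ⁆ (j.removeNth (i.castSucc.removeNth x)))
      map_update_add' := fun x i a b => by
        simp only [ceSum_eq]
        rw [AlternatingMap.map_update_add, smul_add]
      map_update_smul' := fun x i c a => by
        simp only [ceSum_eq]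
        rw [AlternatingMap.map_update_smul, smul_comm]
      map_eq_zero_of_eq' := fun x i j hx hij => by
        simp only [ceSum_eq]
        rw [AlternatingMap.map_eq_zero_of_eq _ x hx hij, smul_zero] }
  map_add' φ ψ := by
    ext x
    simp only [AlternatingMap.add_apply, AlternatingMap.coe_mk, MultilinearMap.coe_mk, smul_add,
      Finset.sum_add_distrib]
  map_smul' c φ := by
    ext x
    simp only [AlternatingMap.smul_apply, AlternatingMap.coe_mk, MultilinearMap.coe_mk,
      RingHom.id_apply, smul_comm _ c, Finset.smul_sum]

end ChevalleyEilenberg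

section Total
variable (E : Type*) [NormedAddCommGroup E] [NormedSpace ℝ E]
variable (M : Type*) [TopologicalSpace M] [ChartedSpace E M] [IsManifold 𝓘(ℝ, E) ∞ M]
variable (F : Type*) [NormedAddCommGroup F] [NormedSpace ℝ F] [CompleteSpace F]
variable (G : Type*) [TopologicalSpace G] [ChartedSpace F G] [Group G] [LieGroup 𝓘(ℝ, F) ∞ G]

/-- The bidegrees `(r, l)` with `r ≥ 1` and `r + l = n`, written as `r = k + 1`. -/
structure Bidegree (n : ℕ) where
  k : ℕ
  l : ℕ
  sum_eq : k + 1 + l = n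

/-- The part of total degree `n` of `Λ^{≥1} 𝔤* ⊗ Ω(M)`: families `φ_r : Λ^r 𝔤 → Ω^{n-r}(M)`,
`r = 1, …, n`. (As `𝔤` is finite-dimensional, `Λ^r 𝔤* ⊗ Ω^l(M)` is the space of alternating
`r`-linear maps from `𝔤` to `Ω^l(M)`.) -/
abbrev TotalComplex (n : ℕ) : Type _ :=
  ∀ q : Bidegree n, GroupLieAlgebra 𝓘(ℝ, F) G [⋀^Fin (q.k + 1)]→ₗ[ℝ] DiffForm E M q.l

variable {E M F G}

/-- The component of `d_𝔤 φ` in bidegree `(k + 1, l)`. -/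
def cePart {n : ℕ} (φ : TotalComplex E M F G n) : (k l : ℕ) → k + 1 + l = n + 1 →
    GroupLieAlgebra 𝓘(ℝ, F) G [⋀^Fin (k + 1)]→ₗ[ℝ] DiffForm E M l
  | 0, _, _ => 0
  | k + 1, l, h => ceD (L := GroupLieAlgebra 𝓘(ℝ, F) G) (W := DiffForm E M l) k (φ ⟨k, l, by omega⟩)

/-- The component of `d φ` (applied to values) in bidegree `(k + 1, l)`. -/
def deRhamPart {n : ℕ} (φ : TotalComplex E M F G n) : (k l : ℕ) → k + 1 + l = n + 1 →
    GroupLieAlgebra 𝓘(ℝ, F) G [⋀^Fin (k + 1)]→ₗ[ℝ] DiffForm E M l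
  | _, 0, _ => 0
  | k, l + 1, h => (extD l).compAlternatingMap (φ ⟨k, l, by omega⟩)

/-- The total differential, equal to `d_𝔤 + (-1)^r d` on `Λ^r 𝔤* ⊗ Ω(M)`. -/
def dTot (n : ℕ) : TotalComplex E M F G n →ₗ[ℝ] TotalComplex E M F G (n + 1) where
  toFun φ q := cePart φ q.k q.l q.sum_eq + (-1 : ℝ) ^ (q.k + 1) • deRhamPart φ q.k q.l q.sum_eq
  map_add' φ ψ := by
    funext ⟨k, l, h⟩
    have h1 : cePart (φ + ψ) k l h = cePart φ k l h + cePart ψ k l h := by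
      cases k with
      | zero => exact (add_zero _).symm
      | succ k => exact map_add (ceD k) _ _
    have h2 : deRhamPart (φ + ψ) k l h = deRhamPart φ k l h + deRhamPart ψ k l h := by
      cases l with
      | zero => exact (add_zero _).symm
      | succ l => ext x : 1; exact map_add (extD l) _ _
    change cePart (φ + ψ) k l h + _ • deRhamPart (φ + ψ) k l h =
      (cePart φ k l h + _ • deRhamPart φ k l h) + (cePart ψ k l h + _ • deRhamPart ψ k l h)
    rw [h1, h2, smul_add, add_add_add_comm]
  map_smul' c φ := by
    funext ⟨k, l, h⟩
    have h1 : cePart (c • φ) k l h = c • cePart φ k l h := by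
      cases k with
      | zero => exact (smul_zero _).symm
      | succ k => exact map_smul (ceD k) _ _
    have h2 : deRhamPart (c • φ) k l h = c • deRhamPart φ k l h := by
      cases l with
      | zero => exact (smul_zero _).symm
      | succ l => ext x : 1; exact map_smul (extD l) _ _
    change cePart (c • φ) k l h + _ • deRhamPart (c • φ) k l h =
      c • (cePart φ k l h + _ • deRhamPart φ k l h)
    rw [h1, h2, smul_add, smul_comm]

/-- `ς(k) = -(-1)^{k(k+1)/2}`. -/
def varsigma (k : ℕ) : ℝ := -(-1) ^ (k * (k + 1) / 2)

/-- `(φ_k) ↦ (ς(k) φ_k)`. -/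
def signTwist (n : ℕ) : TotalComplex E M F G n →ₗ[ℝ] TotalComplex E M F G n where
  toFun φ q := varsigma (q.k + 1) • φ q
  map_add' φ ψ := by funext q; exact smul_add _ _ _
  map_smul' c φ := by funext q; exact smul_comm _ c (φ q)

/-- An `l`-form `α` is Hamiltonian for the `(l + 2)`-form `σ` if `dα = -ι_V σ` for some vector
field `V`. -/
def IsHamiltonian {n l : ℕ} (h : l + 1 = n) (σ : DiffForm E M (n + 1)) (α : DiffForm E M l) :
    Prop :=
  ∃ V : VecField E M, extD l α = -contract (by omega : (l + 1) + 1 = n + 1) ![V] σ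

variable [MulAction G M] [ContMDiffSMul 𝓘(ℝ, F) 𝓘(ℝ, E) ∞ G M]

variable (F G) in
/-- `σ̃ = ∑_{k=1}^N (-1)^{k-1} σ_k` with `σ_k(x_1, …, x_k) = ι(v_{x_1} ∧ ⋯ ∧ v_{x_k}) σ`. -/
def tilde {N : ℕ} (σ : DiffForm E M N) : TotalComplex E M F G N := fun q =>
  (-1 : ℝ) ^ q.k • contractGen F G (by have := q.sum_eq; omega : q.l + (q.k + 1) = N) σ

/-- The maps `f_k : Λ^k 𝔤 → Ω^{n-k}(M)`, `k = 1, …, n`, are the components of an `L∞`-morphism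
from `𝔤` to the `L∞`-algebra of observables of `(M, σ)`, the degree zero part of which consists of
the Hamiltonian `(n-1)`-forms. The sums over pairs `a < b` are encoded as in `ceD`; the sign
`(-1)^{a+b+1}` is `(-1)^{i+j}`. -/
structure IsLInftyMorphism {n : ℕ} (σ : DiffForm E M (n + 1)) (f : TotalComplex E M F G n) :
    Prop where
  hamiltonian : ∀ (l : ℕ) (h : 0 + 1 + l = n) (x : GroupLieAlgebra 𝓘(ℝ, F) G),
    IsHamiltonian (by omega : l + 1 = n) σ (f ⟨0, l, h⟩ ![x])
  /-- The relation with `r = k + 2` arguments, `2 ≤ r ≤ n`. -/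
  main : ∀ (k l : ℕ) (h : k + 2 + l = n) (x : Fin (k + 2) → GroupLieAlgebra 𝓘(ℝ, F) G),
    ∑ i : Fin (k + 1), ∑ j ≥ i, (-1 : ℝ) ^ ((i : ℕ) + j) • f ⟨k, l + 1, by omega⟩
        (Matrix.vecCons ⁅x i.castSucc, x j.succ⁆ (j.removeNth (i.castSucc.removeNth x))) =
      extD l (f ⟨k + 1, l, by omega⟩ x) +
        varsigma (k + 2) • contract (by omega : (l + 1) + (k + 2) = n + 1)
          (fun i => generator E M (x i)) σ
  /-- The relation with `n + 1 = k + 2` arguments. -/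
  last : ∀ (k : ℕ) (h : k + 1 = n) (x : Fin (k + 2) → GroupLieAlgebra 𝓘(ℝ, F) G),
    ∑ i : Fin (k + 1), ∑ j ≥ i, (-1 : ℝ) ^ ((i : ℕ) + j) • f ⟨k, 0, by omega⟩
        (Matrix.vecCons ⁅x i.castSucc, x j.succ⁆ (j.removeNth (i.castSucc.removeNth x))) =
      varsigma (n + 1) • contract (by omega : 0 + (k + 2) = n + 1)
        (fun i => generator E M (x i)) σ

/-- Homotopy moment maps for the action of `G` on `(M, σ)`: `L∞`-morphisms with
`d(f_1(x)) = -ι(v_x) σ` for all `x ∈ 𝔤`. -/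
structure IsHomotopyMomentMap {n : ℕ} (σ : DiffForm E M (n + 1)) (f : TotalComplex E M F G n) :
    Prop extends IsLInftyMorphism σ f where
  moment : ∀ (l : ℕ) (h : 0 + 1 + l = n) (x : GroupLieAlgebra 𝓘(ℝ, F) G),
    extD l (f ⟨0, l, h⟩ ![x]) =
      -contract (by omega : (l + 1) + 1 = n + 1) ![generator E M x] σ

end Total
end
end HomotopyMoment

open HomotopyMoment

/-!
For a closed form `σ` of degree `n + 1` preserved by `G`, write
`σ_k(x_1, …, x_k) = ι(v_{x_1} ∧ ⋯ ∧ v_{x_k}) σ`. The heart of the matter is the identity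
`d_𝔤 σ_k = (-1)^{k-1} d σ_{k+1}` (`ceD_contractGen`, with `ceD_contractGen_top` for the top
degree), which says that the components of `d_tot σ̃` cancel in pairs. It is proved by induction on
`k` with two forms of Cartan's calculus.

* On `M`: `L_v = d ι_v + ι_v d` and `[L_v, ι_w] = ι_{[v, w]}` (`lieDeriv_eq_cartan`,
  `lieDeriv_contract`). At a point `p` everything is computed in the preferred chart at `p`, where
  the Lie derivative is given by an explicit formula, `lieDerivAt`; no flows are needed.
* On `𝔤`: `ι_a d_𝔤 + d_𝔤 ι_a` is minus the action of `a` on cochains (`ceD_succ_cons`).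

Two facts on the generators link both sides. Invariance of `σ` gives `L_{v_x} σ = 0`
(`lieDeriv_generator_eq_zero`): differentiate `g^* σ = σ` in `g` at `1` and exchange the derivatives
in `g` and in the point of `M`. Also `[v_x, v_y] = v_{[x, y]}` (`fieldBracket_generator`):
differentiate `(g h) • p = g • (h • p)` in `h` and then in `g`, and antisymmetrize.

Once `d_tot σ̃ = 0` is known, the equation `d_tot φ = σ̃` is compared with the definition of a
homotopy moment map one bidegree at a time (`dTot_eq_tilde_iff`); the signs match because
`ς(k + 1) = (-1)^{k + 1} ς(k)`. The map `signTwist` is an involution, as `ς(k)^2 = 1`, which gives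
the bijection, and the primitives are a fibre of the linear map `d_tot`.
-/

namespace HomotopyMoment
noncomputable section

/-! ### The Lie derivative in a vector space -/
section Flat
variable {E : Type*} [NormedAddCommGroup E] [NormedSpace ℝ E]
variable {F : Type*} [NormedAddCommGroup F] [NormedSpace ℝ F]

/-- The value at `y`, on the constant vectors `w`, of the Lie derivative of the form `η` along the
vector field `X` of a vector space:
`(L_X η)(w_1, …, w_k) = (D_X η)(w_1, …, w_k) + ∑_i η(w_1, …, D_{w_i} X, …, w_k)`. -/
def lieDerivAt {k : ℕ} (X : E → E) (η : E → E [⋀^Fin k]→L[ℝ] ℝ) (y : E) (w : Fin k → E) : ℝ :=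
  fderiv ℝ η y (X y) w + ∑ i, η y (Function.update w i (fderiv ℝ X y (w i)))

lemma extDeriv_apply_cons {k : ℕ} {η : E → E [⋀^Fin (k + 1)]→L[ℝ] ℝ} {y : E}
    (hη : DifferentiableAt ℝ η y) (v : E) (w : Fin (k + 1) → E) :
    extDeriv η y (Fin.cons v w) = fderiv ℝ η y v w -
      ∑ i : Fin (k + 1), (-1) ^ (i : ℕ) • fderiv ℝ η y (w i) (Fin.cons v (i.removeNth w)) := by
  rw [extDeriv_apply hη, Fin.sum_univ_succ, sub_eq_add_neg, ← Finset.sum_neg_distrib]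
  simp only [fderiv_continuousAlternatingMap_apply_const_apply hη]
  congr 1
  · simp
  · refine Finset.sum_congr rfl fun i _ => ?_
    have : (Fin.succ i).removeNth (Fin.cons v w : Fin (k + 2) → E) =
        Fin.cons v (i.removeNth w) := by
      funext j
      refine Fin.cases ?_ (fun j => ?_) j <;> simp [Fin.removeNth]
    rw [this]
    simp [pow_succ]

/-- Cartan's formula `L_X = d ι_X + ι_X d` in positive degree. -/
lemma lieDerivAt_eq_cartan {k : ℕ} {X : E → E} {η : E → E [⋀^Fin (k + 1)]→L[ℝ] ℝ} {y : E}
    (hX : DifferentiableAt ℝ X y) (hη : DifferentiableAt ℝ η y) (w : Fin (k + 1) → E) :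
    lieDerivAt X η y w = extDeriv (fun z => (η z).curryLeft (X z)) y w +
      extDeriv η y (Fin.cons (X y) w) := by
  have hc : DifferentiableAt ℝ (fun z => (η z).curryLeft (X z)) y :=
    DifferentiableAt.clm_apply (c := fun z => ContinuousAlternatingMap.curryLeftLI (𝕜 := ℝ) (E := E)
      (F := ℝ) (n := k) (η z)) ((ContinuousAlternatingMap.curryLeftLI (𝕜 := ℝ) (E := E) (F := ℝ)
      (n := k)).toContinuousLinearMap.differentiableAt.comp y hη) hX
  have hd : ∀ (i : Fin (k + 1)), fderiv ℝ (fun z => (η z).curryLeft (X z) (i.removeNth w)) y (w i) =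
      fderiv ℝ η y (w i) (Fin.cons (X y) (i.removeNth w)) +
        η y (Fin.cons (fderiv ℝ X y (w i)) (i.removeNth w)) := by
    intro i
    have hcons : ∀ z, (fun j : Fin (k + 1) => (Fin.cons X (fun j _ => i.removeNth w j) :
        Fin (k + 1) → E → E) j z) = Fin.cons (X z) (i.removeNth w) := by
      intro z; funext j; refine Fin.cases ?_ (fun j => ?_) j <;> simp
    have hg : ∀ j, DifferentiableAt ℝ ((Fin.cons X (fun j _ => i.removeNth w j) :
        Fin (k + 1) → E → E) j) y := by
      intro j; refine Fin.cases ?_ (fun j => ?_) j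
      · exact hX
      · exact differentiableAt_const _
    have := fderiv_continuousAlternatingMap_apply_apply hη hg (w i)
    simp only [hcons] at this
    rw [Fin.sum_univ_succ] at this
    refine this.trans ?_
    rw [add_right_inj]
    refine (add_eq_left.2 ?_).trans ?_
    · refine Finset.sum_eq_zero fun j _ => ?_
      refine (η y).map_coord_zero j.succ ?_
      simp
    · simp [Fin.update_cons_zero]
  rw [extDeriv_apply hc, extDeriv_apply_cons hη]
  simp only [hd, smul_add, Finset.sum_add_distrib, lieDerivAt]
  have hu : ∀ i : Fin (k + 1), η y (Function.update w i (fderiv ℝ X y (w i))) =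
      (-1) ^ (i : ℕ) • η y (Fin.cons (fderiv ℝ X y (w i)) (i.removeNth w)) := by
    intro i
    have := (η y).map_insertNth i (fderiv ℝ X y (w i)) (i.removeNth w)
    rw [Fin.insertNth_removeNth] at this
    exact this
  simp only [hu]
  ring

lemma lieDerivAt_zero_form {X : E → E} {η : E → E [⋀^Fin 0]→L[ℝ] ℝ} {y : E}
    (hη : DifferentiableAt ℝ η y) (w : Fin 0 → E) :
    lieDerivAt X η y w = extDeriv η y (Fin.cons (X y) w) := by
  rw [extDeriv_apply hη]
  simp only [lieDerivAt, fderiv_continuousAlternatingMap_apply_const_apply hη]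
  simp

/-- The derivation rule `L_X ι(W_1 ∧ ⋯ ∧ W_k) η = ι(W_1 ∧ ⋯ ∧ W_k) L_X η +
∑_i ι(W_1 ∧ ⋯ ∧ [X, W_i] ∧ ⋯ ∧ W_k) η`. -/
lemma lieDerivAt_contract {k l N : ℕ} (h : N = k + l) {X : E → E} {W : Fin k → E → E}
    {η : E → E [⋀^Fin N]→L[ℝ] ℝ} {τ : E → E [⋀^Fin l]→L[ℝ] ℝ} {y : E}
    (hη : DifferentiableAt ℝ η y) (hτ : DifferentiableAt ℝ τ y)
    (hW : ∀ i, DifferentiableAt ℝ (W i) y)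
    (heq : ∀ᶠ z in 𝓝 y, ∀ w, τ z w = η z (Fin.append (fun i => W i z) w ∘ Fin.cast h))
    (w : Fin l → E) :
    lieDerivAt X τ y w = lieDerivAt X η y (Fin.append (fun i => W i y) w ∘ Fin.cast h) +
      ∑ i, η y (Fin.append (Function.update (fun i => W i y) i
        (VectorField.lieBracket ℝ X (W i) y)) w ∘ Fin.cast h) := by
  subst h
  have hid : ∀ f : Fin (k + l) → E, f ∘ Fin.cast rfl = f := fun f => rfl
  simp only [hid] at heq ⊢
  have hg : ∀ j, DifferentiableAt ℝ ((Fin.append W (fun j _ => w j) : Fin (k + l) → E → E) j) y := by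
    intro j; refine Fin.addCases (fun j => ?_) (fun j => ?_) j
    · simpa using hW j
    · simp
  have happ : ∀ z, (fun j => (Fin.append W (fun j _ => w j) : Fin (k + l) → E → E) j z) =
      Fin.append (fun i => W i z) w := by
    intro z; funext j; refine Fin.addCases (fun j => ?_) (fun j => ?_) j <;> simp
  have h1 : fderiv ℝ τ y (X y) w = fderiv ℝ η y (X y) (Fin.append (fun i => W i y) w) +
      ∑ i, η y (Fin.append (Function.update (fun i => W i y) i (fderiv ℝ (W i) y (X y))) w) := by
    rw [← fderiv_continuousAlternatingMap_apply_const_apply hτ]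
    have he : (fun z => τ z w) =ᶠ[𝓝 y] fun z => η z (Fin.append (fun i => W i z) w) :=
      heq.mono fun z hz => hz w
    rw [he.fderiv_eq]
    have := fderiv_continuousAlternatingMap_apply_apply hη hg (X y)
    simp only [happ] at this
    rw [this, Fin.sum_univ_add, add_right_inj]
    refine (add_eq_left.2 ?_).trans ?_
    · refine Finset.sum_eq_zero fun j _ => (η y).map_coord_zero (Fin.natAdd k j) ?_
      simp
    · refine Finset.sum_congr rfl fun i _ => ?_
      have := append_update (rfl : k + l = k + l) i (fun i => W i y) w (fderiv ℝ (W i) y (X y))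
      simp only [hid] at this
      rw [this]
      simp
  have h2 : ∀ i : Fin k, η y (Fin.append (Function.update (fun i => W i y) i
        (VectorField.lieBracket ℝ X (W i) y)) w) =
      η y (Fin.append (Function.update (fun i => W i y) i (fderiv ℝ (W i) y (X y))) w) -
      η y (Fin.append (Function.update (fun i => W i y) i (fderiv ℝ X y (W i y))) w) := by
    intro i
    have := fun a => append_update (rfl : k + l = k + l) i (fun i => W i y) w a
    simp only [hid] at this
    simp only [this, VectorField.lieBracket]
    exact (η y).map_update_sub _ _ _ _
  have h3 : ∀ i : Fin k, Function.update (Fin.append (fun i => W i y) w) (Fin.castAdd l i)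
      (fderiv ℝ X y (W i y)) =
      Fin.append (Function.update (fun i => W i y) i (fderiv ℝ X y (W i y))) w := fun i => by
    have := append_update (rfl : k + l = k + l) i (fun i => W i y) w (fderiv ℝ X y (W i y))
    simp only [hid] at this
    rw [this]; rfl
  have h4 : ∀ j : Fin l, τ y (Function.update w j (fderiv ℝ X y (w j))) =
      η y (Function.update (Fin.append (fun i => W i y) w) (Fin.natAdd k j)
        (fderiv ℝ X y (w j))) := fun j => by
    rw [heq.self_of_nhds]
    congr 1
    funext a
    refine Fin.addCases (fun a => ?_) (fun a => ?_) a
    · have : Fin.castAdd l a ≠ Fin.natAdd k j := fun hh => by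
        have := congrArg Fin.val hh; simp at this; omega
      simp [this]
    · by_cases haj : a = j
      · subst haj; simp
      · simp [haj]
  simp only [lieDerivAt, h1, h2, h4, Fin.sum_univ_add, Fin.append_left, Fin.append_right, h3,
    Finset.sum_sub_distrib]
  ring

/-- Symmetry of the mixed second derivatives of a function of two variables. -/
lemma fderiv_fderiv_comm {H : Type*} [NormedAddCommGroup H] [NormedSpace ℝ H] {Φ : F × E → H}
    {e : F} {y : E} (hΦ : ContDiffAt ℝ 2 Φ (e, y)) (u : F) (w : E) :
    fderiv ℝ (fun a => fderiv ℝ (fun z => Φ (a, z)) y w) e u =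
      fderiv ℝ (fun z => fderiv ℝ (fun a => Φ (a, z)) e u) y w := by
  have hev : ∀ᶠ q in 𝓝 (e, y), DifferentiableAt ℝ Φ q :=
    (hΦ.eventually (by simp)).mono fun q hq => hq.differentiableAt (by simp)
  have hd : DifferentiableAt ℝ (fderiv ℝ Φ) (e, y) :=
    (hΦ.fderiv_right (m := 1) (by norm_num)).differentiableAt (by simp)
  have ca : ContinuousAt (fun a : F => (a, y)) e := by fun_prop
  have cz : ContinuousAt (fun z : E => (e, z)) y := by fun_prop
  have h1 : (fun a => fderiv ℝ (fun z => Φ (a, z)) y w) =ᶠ[𝓝 e]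
      fun a => fderiv ℝ Φ (a, y) (0, w) := by
    filter_upwards [ca.eventually hev] with a ha
    have : HasFDerivAt (fun z => Φ (a, z)) _ y :=
      ha.hasFDerivAt.comp y ((hasFDerivAt_const a y).prodMk (hasFDerivAt_id y))
    rw [this.fderiv]; simp
  have h2 : (fun z => fderiv ℝ (fun a => Φ (a, z)) e u) =ᶠ[𝓝 y]
      fun z => fderiv ℝ Φ (e, z) (u, 0) := by
    filter_upwards [cz.eventually hev] with z hz
    have : HasFDerivAt (fun a => Φ (a, z)) _ e :=
      HasFDerivAt.comp e (f := fun a => (a, z)) hz.hasFDerivAt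
        ((hasFDerivAt_id e).prodMk (hasFDerivAt_const z e))
    rw [this.fderiv]; simp
  rw [h1.fderiv_eq, h2.fderiv_eq]
  have h3 : HasFDerivAt (fun a => fderiv ℝ Φ (a, y) (0, w)) _ e :=
    (HasFDerivAt.comp e (f := fun a => (a, y)) hd.hasFDerivAt
        ((hasFDerivAt_id e).prodMk (hasFDerivAt_const y e))).clm_apply (hasFDerivAt_const _ _)
  have h4 : HasFDerivAt (fun z => fderiv ℝ Φ (e, z) (u, 0)) _ y :=
    (HasFDerivAt.comp y (f := fun z => (e, z)) hd.hasFDerivAt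
        ((hasFDerivAt_const e y).prodMk (hasFDerivAt_id y))).clm_apply (hasFDerivAt_const _ _)
  rw [h3.fderiv, h4.fderiv]
  simpa using (hΦ.isSymmSndFDerivAt (by simp)) (u, 0) (0, w)

/-- Partial derivatives of a `C^2` function of two variables are differentiable in the other
variable. -/
lemma differentiableAt_partial_fderiv {H : Type*} [NormedAddCommGroup H] [NormedSpace ℝ H]
    {Φ : F × E → H} {e : F} {y : E} (hΦ : ContDiffAt ℝ 2 Φ (e, y)) (w : E) :
    DifferentiableAt ℝ (fun a => fderiv ℝ (fun z => Φ (a, z)) y w) e := by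
  have hev : ∀ᶠ q in 𝓝 (e, y), DifferentiableAt ℝ Φ q :=
    (hΦ.eventually (by simp)).mono fun q hq => hq.differentiableAt (by simp)
  have hd : DifferentiableAt ℝ (fderiv ℝ Φ) (e, y) :=
    (hΦ.fderiv_right (m := 1) (by norm_num)).differentiableAt (by simp)
  have ca : ContinuousAt (fun a : F => (a, y)) e := by fun_prop
  have h1 : (fun a => fderiv ℝ (fun z => Φ (a, z)) y w) =ᶠ[𝓝 e]
      fun a => fderiv ℝ Φ (a, y) (0, w) := by
    filter_upwards [ca.eventually hev] with a ha
    have : HasFDerivAt (fun z => Φ (a, z)) _ y :=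
      ha.hasFDerivAt.comp y ((hasFDerivAt_const a y).prodMk (hasFDerivAt_id y))
    rw [this.fderiv]; simp
  refine DifferentiableAt.congr_of_eventuallyEq ?_ h1
  have hd' : DifferentiableAt ℝ (fun a => fderiv ℝ Φ (a, y)) e :=
    DifferentiableAt.comp e (f := fun a => (a, y)) hd (by fun_prop)
  exact hd'.clm_apply (differentiableAt_const _)

/-- If the maps `Φ(a, ·)` preserve `η` to first order at `y`, for `a` close to `e`, then the Lie
derivative of `η` at `y` along the generating field `z ↦ ∂_u Φ(·, z)` vanishes. -/
lemma lieDerivAt_eq_zero_of_invariant {k : ℕ} {Φ : F × E → E} {e : F} {y : E}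
    (hΦ : ContDiffAt ℝ 2 Φ (e, y)) (hid : ∀ᶠ z in 𝓝 y, Φ (e, z) = z)
    {η : E → E [⋀^Fin k]→L[ℝ] ℝ} (hη : DifferentiableAt ℝ η y) (w : Fin k → E)
    (hinv : ∀ᶠ a in 𝓝 e, η (Φ (a, y)) (fun i => fderiv ℝ (fun z => Φ (a, z)) y (w i)) = η y w)
    (u : F) :
    lieDerivAt (fun z => fderiv ℝ (fun a => Φ (a, z)) e u) η y w = 0 := by
  have hy : Φ (e, y) = y := hid.self_of_nhds
  have hD : ∀ v, fderiv ℝ (fun z => Φ (e, z)) y v = v := fun v => by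
    rw [Filter.EventuallyEq.fderiv_eq (f := id) hid, fderiv_id]; rfl
  have hΦa : DifferentiableAt ℝ (fun a => Φ (a, y)) e :=
    DifferentiableAt.comp e (f := fun a => (a, y)) (hΦ.differentiableAt (by simp)) (by fun_prop)
  have hηΦ : HasFDerivAt (fun a => η (Φ (a, y))) _ e :=
    HasFDerivAt.comp e (by rw [hy]; exact hη.hasFDerivAt) hΦa.hasFDerivAt
  have h0 := Filter.EventuallyEq.fderiv_eq (𝕜 := ℝ) (f := fun _ => η y w) hinv
  have h1 := fderiv_continuousAlternatingMap_apply_apply hηΦ.differentiableAt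
    (fun i => differentiableAt_partial_fderiv hΦ (w i)) u
  rw [h0, hηΦ.fderiv] at h1
  simp only [hD, hy, fderiv_fderiv_comm hΦ] at h1
  rw [lieDerivAt]
  simpa using h1.symm

/-- The commutator of the generating fields of a local action `Φ` of a local group law `μ`,
expressed through the commutator of the left-invariant fields of `μ`. -/
lemma lieBracket_generating_fields {Φ : F × E → E} {μ : F × F → F} {e : F} {y : E}
    (hΦ : ContDiffAt ℝ 2 Φ (e, y)) (hμ : ContDiffAt ℝ 2 μ (e, e))
    (hid : ∀ᶠ z in 𝓝 y, Φ (e, z) = z) (hμe : ∀ᶠ a in 𝓝 e, μ (a, e) = a)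
    (hμl : ∀ᶠ b in 𝓝 e, μ (e, b) = b)
    (hact : ∀ᶠ a in 𝓝 e, ∀ᶠ b in 𝓝 e, Φ (μ (a, b), y) = Φ (a, Φ (b, y))) (u v : F) :
    fderiv ℝ (fun a => Φ (a, y)) e (VectorField.lieBracket ℝ
        (fun a => fderiv ℝ (fun b => μ (a, b)) e u) (fun a => fderiv ℝ (fun b => μ (a, b)) e v) e) =
      VectorField.lieBracket ℝ (fun z => fderiv ℝ (fun a => Φ (a, z)) e v)
        (fun z => fderiv ℝ (fun a => Φ (a, z)) e u) y := by
  have hy : Φ (e, y) = y := hid.self_of_nhds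
  have ca : ContinuousAt (fun a : F => (a, y)) e := by fun_prop
  have cb : ContinuousAt (fun a : F => (a, e)) e := by fun_prop
  have hevΦ : ∀ᶠ q in 𝓝 (e, y), DifferentiableAt ℝ Φ q :=
    (hΦ.eventually (by simp)).mono fun q hq => hq.differentiableAt (by simp)
  have hevμ : ∀ᶠ q in 𝓝 (e, e), DifferentiableAt ℝ μ q :=
    (hμ.eventually (by simp)).mono fun q hq => hq.differentiableAt (by simp)
  have hμD : ∀ x, fderiv ℝ (fun b => μ (e, b)) e x = x := fun x => by
    rw [Filter.EventuallyEq.fderiv_eq (f := id) hμl, fderiv_id]; rfl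
  have hda : ∀ a, DifferentiableAt ℝ Φ (a, y) → DifferentiableAt ℝ (fun c => Φ (c, y)) a :=
    fun a ha => DifferentiableAt.comp a (f := fun c => (c, y)) ha (by fun_prop)
  -- the derivative at `b = e` of the action law
  have key : ∀ x, (fun a => fderiv ℝ (fun c => Φ (c, y)) a (fderiv ℝ (fun b => μ (a, b)) e x))
      =ᶠ[𝓝 e] fun a => fderiv ℝ (fun z => Φ (a, z)) y (fderiv ℝ (fun c => Φ (c, y)) e x) := by
    intro x
    filter_upwards [hact, hμe, ca.eventually hevΦ, cb.eventually hevμ] with a ha hae hdΦ hdμ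
    have h1 : DifferentiableAt ℝ (fun b => μ (a, b)) e :=
      DifferentiableAt.comp e (f := fun b => (a, b)) hdμ (by fun_prop)
    have h2 : HasFDerivAt (fun b => Φ (μ (a, b), y)) _ e :=
      HasFDerivAt.comp e (f := fun b => μ (a, b)) (g := fun c => Φ (c, y))
        (by rw [hae]; exact (hda a hdΦ).hasFDerivAt) h1.hasFDerivAt
    have h3 : DifferentiableAt ℝ (fun z => Φ (a, z)) y :=
      DifferentiableAt.comp y (f := fun z => (a, z)) hdΦ (by fun_prop)
    have h4 : HasFDerivAt (fun b => Φ (a, Φ (b, y))) _ e :=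
      HasFDerivAt.comp e (f := fun b => Φ (b, y)) (g := fun z => Φ (a, z))
        (by rw [hy]; exact h3.hasFDerivAt)
        (hda e hevΦ.self_of_nhds).hasFDerivAt
    have h5 := Filter.EventuallyEq.fderiv_eq (𝕜 := ℝ) ha
    rw [h2.fderiv, h4.fderiv] at h5
    exact DFunLike.congr_fun h5 x
  have hΦ2 : ContDiffAt ℝ 2 (fun a => Φ (a, y)) e :=
    ContDiffAt.comp e (f := fun a => (a, y)) hΦ (by fun_prop)
  have hdd : DifferentiableAt ℝ (fderiv ℝ (fun a => Φ (a, y))) e :=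
    (hΦ2.fderiv_right (m := 1) (by norm_num)).differentiableAt (by simp)
  -- the derivative at `a = e` of the previous identity
  have key2 : ∀ x z, fderiv ℝ (fderiv ℝ (fun a => Φ (a, y))) e z x +
      fderiv ℝ (fun a => Φ (a, y)) e (fderiv ℝ (fun a => fderiv ℝ (fun b => μ (a, b)) e x) e z) =
      fderiv ℝ (fun q => fderiv ℝ (fun a => Φ (a, q)) e z) y (fderiv ℝ (fun c => Φ (c, y)) e x) := by
    intro x z
    rw [← fderiv_fderiv_comm hΦ, ← (key x).fderiv_eq,
      (hdd.hasFDerivAt.clm_apply (differentiableAt_partial_fderiv hμ x).hasFDerivAt).fderiv]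
    simp [hμD, add_comm]
  have hs := (hΦ2.isSymmSndFDerivAt (by simp)) u v
  have ha := key2 u v
  have hb := key2 v u
  simp only [VectorField.lieBracket, hμD, map_sub]
  rw [← ha, ← hb, hs]
  abel

end Flat

/-! ### The Lie derivative on a manifold -/
section Global
variable {E : Type*} [NormedAddCommGroup E] [NormedSpace ℝ E]
variable {M : Type*} [TopologicalSpace M] [ChartedSpace E M]

/-- The value of a form at `p`, the tangent space at `p` being identified with the model space. -/
def evalForm {k : ℕ} (σ : DiffForm E M k) (p : M) (w : Fin k → E) : ℝ := σ.1 p w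

lemma evalForm_ext {k : ℕ} {σ τ : DiffForm E M k}
    (h : ∀ (p : M) (w : Fin k → E), evalForm σ p w = evalForm τ p w) : σ = τ :=
  diffForm_ext h

lemma evalForm_add {k : ℕ} (σ τ : DiffForm E M k) (p : M) (w : Fin k → E) :
    evalForm (σ + τ) p w = evalForm σ p w + evalForm τ p w := rfl

lemma evalForm_zero {k : ℕ} (p : M) (w : Fin k → E) :
    evalForm (0 : DiffForm E M k) p w = 0 := rfl

lemma evalForm_smul {k : ℕ} (c : ℝ) (σ : DiffForm E M k) (p : M) (w : Fin k → E) :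
    evalForm (c • σ) p w = c * evalForm σ p w := rfl

lemma evalForm_sum {ι : Type*} {k : ℕ} (s : Finset ι) (σ : ι → DiffForm E M k) (p : M)
    (w : Fin k → E) : evalForm (∑ i ∈ s, σ i) p w = ∑ i ∈ s, evalForm (σ i) p w :=
  map_sum (AddMonoidHom.mk' (fun σ : DiffForm E M k => evalForm σ p w)
    fun σ τ => evalForm_add σ τ p w) σ s

/-- The alternating map underlying `evalForm`. -/
def valueForm {k : ℕ} (σ : DiffForm E M k) (p : M) : E [⋀^Fin k]→L[ℝ] ℝ := σ.1 p

lemma evalForm_eq {k : ℕ} (σ : DiffForm E M k) (p : M) (w : Fin k → E) :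
    evalForm σ p w = valueForm σ p w := rfl

/-- The form `σ` written in the preferred chart at `x`. -/
def localForm {k : ℕ} (σ : DiffForm E M k) (x : M) : E → E [⋀^Fin k]→L[ℝ] ℝ := localRep σ.1 x

lemma differentiableAt_localForm {k : ℕ} (σ : DiffForm E M k) (p : M) :
    DifferentiableAt ℝ (localForm σ p) (extChartAt 𝓘(ℝ, E) p p) :=
  ((σ.2 p).contDiffAt (extChartAt_target_mem_nhds p)).differentiableAt (by simp)

variable [IsManifold 𝓘(ℝ, E) ∞ M]

/-- The value of a vector field at `p`, the tangent space at `p` being identified with the model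
space. -/
def evalField (V : VecField E M) (p : M) : E := V p

/-- The vector field `V` written in the preferred chart at `x`. -/
def localField (V : VecField E M) (x : M) (y : E) : E :=
  mfderiv 𝓘(ℝ, E) 𝓘(ℝ, E) (extChartAt 𝓘(ℝ, E) x) ((extChartAt 𝓘(ℝ, E) x).symm y)
    (V ((extChartAt 𝓘(ℝ, E) x).symm y))

lemma mfderiv_chart_symm_apply_localField (V : VecField E M) (x : M) {y : E}
    (hy : y ∈ (extChartAt 𝓘(ℝ, E) x).target) :
    (mfderiv 𝓘(ℝ, E) 𝓘(ℝ, E) (extChartAt 𝓘(ℝ, E) x).symm y (localField (E := E) V x y) : E) =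
      V ((extChartAt 𝓘(ℝ, E) x).symm y) := by
  have hid := mfderivWithin_extChartAt_symm_comp_mfderiv_extChartAt (I := 𝓘(ℝ, E)) hy
  rw [ModelWithCorners.range_eq_univ, mfderivWithin_univ] at hid
  exact DFunLike.congr_fun hid (V ((extChartAt 𝓘(ℝ, E) x).symm y))

lemma differentiableAt_localField (V : VecField E M) (p : M) :
    DifferentiableAt ℝ (localField V p) (extChartAt 𝓘(ℝ, E) p p) :=
  ((contDiffOn_vecField V p).contDiffAt (extChartAt_target_mem_nhds p)).differentiableAt (by simp)

lemma mfderiv_chart_self_apply (p : M) (v : E) :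
    (mfderiv 𝓘(ℝ, E) 𝓘(ℝ, E) (extChartAt 𝓘(ℝ, E) p) p v : E) = v := by
  rw [mfderiv_extChartAt_self]; rfl

lemma mfderiv_chart_symm_self_apply (p : M) (v : E) :
    (mfderiv 𝓘(ℝ, E) 𝓘(ℝ, E) (extChartAt 𝓘(ℝ, E) p).symm (extChartAt 𝓘(ℝ, E) p p) v : E) = v := by
  have h := mfderivWithin_range_extChartAt_symm (I := 𝓘(ℝ, E)) (x := p)
  rw [ModelWithCorners.range_eq_univ, mfderivWithin_univ] at h
  rw [h]; rfl

lemma localField_self (V : VecField E M) (p : M) :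
    localField V p (extChartAt 𝓘(ℝ, E) p p) = evalField V p := by
  have key : ∀ q : M, q = p → (mfderiv 𝓘(ℝ, E) 𝓘(ℝ, E) (extChartAt 𝓘(ℝ, E) p) q (V q) : E) =
      V p := by
    rintro q rfl; exact mfderiv_chart_self_apply q _
  exact key _ (extChartAt_to_inv p)

lemma localForm_self {k : ℕ} (σ : DiffForm E M k) (p : M) (w : Fin k → E) :
    localForm σ p (extChartAt 𝓘(ℝ, E) p p) w = evalForm σ p w := by
  have key : ∀ (q : M) (A : E →L[ℝ] TangentSpace 𝓘(ℝ, E) q), q = p → (∀ v, (A v : E) = v) →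
      (σ.1 q).compContinuousLinearMap A w = σ.1 p w := by
    rintro q A rfl h
    exact congrArg (σ.1 q) (funext fun i => h (w i))
  exact key _ _ (extChartAt_to_inv p) fun v => mfderiv_chart_symm_self_apply p v

lemma evalForm_extD {k : ℕ} (σ : DiffForm E M k) (p : M) (w : Fin (k + 1) → E) :
    evalForm (extD k σ) p w = extDeriv (localForm σ p) (extChartAt 𝓘(ℝ, E) p p) w :=
  congrArg (extDeriv (localRep σ.1 p) (extChartAt 𝓘(ℝ, E) p p))
    (funext fun i => mfderiv_chart_self_apply p (w i))

lemma evalForm_interiorProd {k : ℕ} (V : VecField E M) (σ : DiffForm E M (k + 1)) (p : M)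
    (w : Fin k → E) :
    evalForm (interiorProd k V σ) p w = evalForm σ p (Fin.cons (evalField V p) w) := rfl

lemma evalForm_contract {k l N : ℕ} (h : l + k = N) (V : Fin k → VecField E M)
    (σ : DiffForm E M N) (p : M) (w : Fin l → E) :
    evalForm (contract h V σ) p w = evalForm σ p
      (Fin.append (fun i => evalField (V i) p) w ∘ Fin.cast (h.symm.trans (Nat.add_comm l k))) :=
  contract_apply h V σ p w

lemma localForm_interiorProd {k : ℕ} (V : VecField E M) (σ : DiffForm E M (k + 1)) (x : M) {y : E}
    (hy : y ∈ (extChartAt 𝓘(ℝ, E) x).target) :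
    localForm (interiorProd k V σ) x y = (localForm σ x y).curryLeft (localField V x y) := by
  ext v
  change σ.1 _ _ = σ.1 _ _
  congr 1
  funext i
  refine Fin.cases ?_ (fun i => ?_) i
  · exact (mfderiv_chart_symm_apply_localField V x hy).symm
  · rfl

lemma localForm_contract {k l N : ℕ} (h : l + k = N) (V : Fin k → VecField E M)
    (σ : DiffForm E M N) (x : M) {y : E} (hy : y ∈ (extChartAt 𝓘(ℝ, E) x).target)
    (w : Fin l → E) :
    localForm (contract h V σ) x y w = localForm σ x y
      (Fin.append (fun i => localField (V i) x y) w ∘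
        Fin.cast (h.symm.trans (Nat.add_comm l k))) := by
  refine (contract_apply h V σ _ _).trans (congrArg (σ.1 _) (funext fun i => ?_))
  obtain ⟨j, rfl⟩ : ∃ j, i = Fin.cast ((Nat.add_comm k l).trans h) j :=
    ⟨Fin.cast (h.symm.trans (Nat.add_comm l k)) i, rfl⟩
  refine Fin.addCases (fun j => ?_) (fun j => ?_) j
  · refine (Fin.append_left _ _ j).trans ((mfderiv_chart_symm_apply_localField (V j) x hy).symm.trans
      ?_)
    exact congrArg (mfderiv 𝓘(ℝ, E) 𝓘(ℝ, E) (extChartAt 𝓘(ℝ, E) x).symm y)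
      (Fin.append_left (fun i => localField (V i) x y) w j).symm
  · refine (Fin.append_right _ _ j).trans ?_
    exact congrArg (mfderiv 𝓘(ℝ, E) 𝓘(ℝ, E) (extChartAt 𝓘(ℝ, E) x).symm y)
      (Fin.append_right (fun i => localField (V i) x y) w j).symm

/-- The Lie derivative of a form along a vector field, at a point `p`, computed in the preferred
chart at `p`. -/
def lieDeriv {k : ℕ} (V : VecField E M) (σ : DiffForm E M k) (p : M) (w : Fin k → E) : ℝ :=
  lieDerivAt (localField V p) (localForm σ p) (extChartAt 𝓘(ℝ, E) p p) w

/-- The value at `p` of the Lie bracket of two vector fields, computed in the preferred chart at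
`p`. -/
def fieldBracket (V W : VecField E M) (p : M) : E :=
  VectorField.lieBracket ℝ (localField V p) (localField W p) (extChartAt 𝓘(ℝ, E) p p)

lemma lieDeriv_eq_cartan {k : ℕ} (V : VecField E M) (σ : DiffForm E M (k + 1)) (p : M)
    (w : Fin (k + 1) → E) :
    lieDeriv V σ p w = evalForm (extD k (interiorProd k V σ)) p w +
      evalForm (interiorProd (k + 1) V (extD (k + 1) σ)) p w := by
  rw [lieDeriv, lieDerivAt_eq_cartan (differentiableAt_localField V p)
    (differentiableAt_localForm σ p), evalForm_extD, evalForm_interiorProd, evalForm_extD,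
    localField_self]
  have he : localForm (interiorProd k V σ) p =ᶠ[𝓝 (extChartAt 𝓘(ℝ, E) p p)]
      fun y => (localForm σ p y).curryLeft (localField V p y) := by
    filter_upwards [extChartAt_target_mem_nhds (I := 𝓘(ℝ, E)) p] with y hy
    exact localForm_interiorProd V σ p hy
  rw [he.extDeriv_eq]

lemma lieDeriv_zero_form (V : VecField E M) (σ : DiffForm E M 0) (p : M) (w : Fin 0 → E) :
    lieDeriv V σ p w = evalForm (interiorProd 0 V (extD 0 σ)) p w := by
  rw [lieDeriv, lieDerivAt_zero_form (differentiableAt_localForm σ p), evalForm_interiorProd,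
    evalForm_extD, localField_self]

lemma lieDeriv_contract {k l N : ℕ} (h : l + k = N) (V : VecField E M) (W : Fin k → VecField E M)
    (σ : DiffForm E M N) (p : M) (w : Fin l → E) :
    lieDeriv V (contract h W σ) p w =
      lieDeriv V σ p (Fin.append (fun i => evalField (W i) p) w ∘
        Fin.cast (h.symm.trans (Nat.add_comm l k))) +
      ∑ i, evalForm σ p (Fin.append (Function.update (fun i => evalField (W i) p) i
        (fieldBracket V (W i) p)) w ∘ Fin.cast (h.symm.trans (Nat.add_comm l k))) := by
  have heq : ∀ᶠ y in 𝓝 (extChartAt 𝓘(ℝ, E) p p), ∀ w, localForm (contract h W σ) p y w =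
      localForm σ p y (Fin.append (fun i => localField (W i) p y) w ∘
        Fin.cast (h.symm.trans (Nat.add_comm l k))) := by
    filter_upwards [extChartAt_target_mem_nhds (I := 𝓘(ℝ, E)) p] with y hy w
    exact localForm_contract h W σ p hy w
  have := lieDerivAt_contract (h.symm.trans (Nat.add_comm l k)) (X := localField V p)
    (W := fun i => localField (W i) p)
    (differentiableAt_localForm σ p) (differentiableAt_localForm (contract h W σ) p)
    (fun i => differentiableAt_localField (W i) p) heq w
  simp only [localField_self, localForm_self] at this
  exact this

end Global

/-! ### Group actions in charts -/
section ActionInChart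
variable {E : Type*} [NormedAddCommGroup E] [NormedSpace ℝ E]
variable {M : Type*} [TopologicalSpace M] [ChartedSpace E M]

/-- At the centre of the preferred chart, the manifold derivative is the derivative in that
chart. -/
lemma fderiv_comp_chart_symm {H : Type*} [NormedAddCommGroup H] [NormedSpace ℝ H] {f : M → H}
    {p : M}
    (hf : MDifferentiableAt 𝓘(ℝ, E) 𝓘(ℝ, H) f p) (v : E) :
    (fderiv ℝ (fun y => f ((extChartAt 𝓘(ℝ, E) p).symm y)) (extChartAt 𝓘(ℝ, E) p p) v : H) =
      mfderiv 𝓘(ℝ, E) 𝓘(ℝ, H) f p v := by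
  rw [hf.mfderiv]
  rw [ModelWithCorners.range_eq_univ, fderivWithin_univ]
  rfl

lemma contMDiff_smul_const {F G : Type*} [NormedAddCommGroup F] [NormedSpace ℝ F]
    [TopologicalSpace G] [ChartedSpace F G] [Group G] [MulAction G M]
    [ContMDiffSMul 𝓘(ℝ, F) 𝓘(ℝ, E) ∞ G M] (p : M) :
    ContMDiff 𝓘(ℝ, F) 𝓘(ℝ, E) ∞ (fun g : G => g • p) :=
  (contMDiff_id (I := 𝓘(ℝ, F)) (M := G)).smul (contMDiff_const (c := p))

lemma contMDiff_smul_left (F : Type*) {G : Type*} [NormedAddCommGroup F] [NormedSpace ℝ F]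
    [TopologicalSpace G] [ChartedSpace F G] [Group G] [MulAction G M]
    [ContMDiffSMul 𝓘(ℝ, F) 𝓘(ℝ, E) ∞ G M] (g : G) :
    ContMDiff 𝓘(ℝ, E) 𝓘(ℝ, E) ∞ (fun q : M => g • q) :=
  (contMDiff_const (I' := 𝓘(ℝ, F)) (c := g)).smul (contMDiff_id (I := 𝓘(ℝ, E)) (M := M))

variable {F : Type*} [NormedAddCommGroup F] [NormedSpace ℝ F]
variable {G : Type*} [TopologicalSpace G] [ChartedSpace F G] [Group G] [MulAction G M]

variable (F G) in
/-- The action of `G` on `M`, written in the preferred charts at `1` and at `p`. -/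
def actionInChart (p : M) (q : F × E) : E :=
  extChartAt 𝓘(ℝ, E) p
    ((extChartAt 𝓘(ℝ, F) (1 : G)).symm q.1 • (extChartAt 𝓘(ℝ, E) p).symm q.2)

lemma actionInChart_one (p : M) : ∀ᶠ z in 𝓝 (extChartAt 𝓘(ℝ, E) p p),
    actionInChart F G p (extChartAt 𝓘(ℝ, F) (1 : G) 1, z) = z := by
  filter_upwards [extChartAt_target_mem_nhds (I := 𝓘(ℝ, E)) p] with z hz
  change extChartAt 𝓘(ℝ, E) p ((extChartAt 𝓘(ℝ, F) (1 : G)).symm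
    (extChartAt 𝓘(ℝ, F) (1 : G) 1) • (extChartAt 𝓘(ℝ, E) p).symm z) = z
  rw [extChartAt_to_inv, one_smul, (extChartAt 𝓘(ℝ, E) p).right_inv hz]

variable [ContMDiffSMul 𝓘(ℝ, F) 𝓘(ℝ, E) ∞ G M]

lemma eventually_chart_symm_smul_mem (p : M) : ∀ᶠ a in 𝓝 (extChartAt 𝓘(ℝ, F) (1 : G) 1),
    (extChartAt 𝓘(ℝ, F) (1 : G)).symm a • p ∈ (extChartAt 𝓘(ℝ, E) p).source := by
  have hc : ContinuousAt (fun a => (extChartAt 𝓘(ℝ, F) (1 : G)).symm a • p)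
      (extChartAt 𝓘(ℝ, F) (1 : G) 1) :=
    ContinuousAt.comp (g := fun g : G => g • p)
      (contMDiff_smul_const (F := F) (E := E) p).continuous.continuousAt
      (continuousAt_extChartAt_symm (I := 𝓘(ℝ, F)) (1 : G))
  refine hc.eventually_mem ?_
  rw [extChartAt_to_inv, one_smul]
  exact extChartAt_source_mem_nhds p

lemma actionInChart_mul [LieGroup 𝓘(ℝ, F) ∞ G] (p : M) :
    ∀ᶠ a in 𝓝 (extChartAt 𝓘(ℝ, F) (1 : G) 1), ∀ᶠ b in 𝓝 (extChartAt 𝓘(ℝ, F) (1 : G) 1),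
      actionInChart F G p (actionInChart F G (1 : G) (a, b), extChartAt 𝓘(ℝ, E) p p) =
        actionInChart F G p (a, actionInChart F G p (b, extChartAt 𝓘(ℝ, E) p p)) := by
  filter_upwards [eventually_chart_symm_smul_mem (F := F) (E := F) (1 : G)] with a ha
  have hc : ContinuousAt (fun b => (extChartAt 𝓘(ℝ, F) (1 : G)).symm a •
      (extChartAt 𝓘(ℝ, F) (1 : G)).symm b) (extChartAt 𝓘(ℝ, F) (1 : G) 1) :=
    ContinuousAt.comp (g := fun g : G => (extChartAt 𝓘(ℝ, F) (1 : G)).symm a • g)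
      (contMDiff_smul_left F (E := F) _).continuous.continuousAt
      (continuousAt_extChartAt_symm (I := 𝓘(ℝ, F)) (1 : G))
  have hev := hc.eventually_mem (s := (extChartAt 𝓘(ℝ, F) (1 : G)).source) (by
    rw [extChartAt_to_inv]
    exact (isOpen_extChartAt_source (1 : G)).mem_nhds ha)
  filter_upwards [hev, eventually_chart_symm_smul_mem (F := F) (E := E) p] with b hb hb'
  simp only [actionInChart, extChartAt_to_inv]
  rw [(extChartAt 𝓘(ℝ, F) (1 : G)).left_inv hb, (extChartAt 𝓘(ℝ, E) p).left_inv hb', smul_eq_mul,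
    mul_smul]

variable [IsManifold 𝓘(ℝ, E) ∞ M]

lemma fderiv_actionInChart_left (p : M) {y : E} (hy : y ∈ (extChartAt 𝓘(ℝ, E) p).target)
    (u : F) :
    fderiv ℝ (fun a => actionInChart F G p (a, y)) (extChartAt 𝓘(ℝ, F) (1 : G) 1) u =
      mfderiv 𝓘(ℝ, E) 𝓘(ℝ, E) (extChartAt 𝓘(ℝ, E) p) ((extChartAt 𝓘(ℝ, E) p).symm y)
        (mfderiv 𝓘(ℝ, F) 𝓘(ℝ, E) (fun g : G => g • (extChartAt 𝓘(ℝ, E) p).symm y) 1 u : E) := by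
  set q := (extChartAt 𝓘(ℝ, E) p).symm y with hq
  have hqs : q ∈ (extChartAt 𝓘(ℝ, E) p).source := (extChartAt 𝓘(ℝ, E) p).map_target hy
  have h1 : MDifferentiableAt 𝓘(ℝ, F) 𝓘(ℝ, E) (fun g : G => g • q) 1 :=
    (contMDiff_smul_const q).mdifferentiableAt (by simp)
  have h2 : MDifferentiableAt 𝓘(ℝ, E) 𝓘(ℝ, E) (extChartAt 𝓘(ℝ, E) p) ((1 : G) • q) := by
    rw [one_smul]; exact mdifferentiableAt_chart p hqs
  refine (fderiv_comp_chart_symm (f := fun g : G => extChartAt 𝓘(ℝ, E) p (g • q))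
    (h2.comp 1 h1) u).trans ?_
  refine (DFunLike.congr_fun (mfderiv_comp (1 : G) h2 h1) u).trans ?_
  have key : ∀ r : M, r = q → ∀ v : E,
      (mfderiv 𝓘(ℝ, E) 𝓘(ℝ, E) (extChartAt 𝓘(ℝ, E) p) r v : E) =
        mfderiv 𝓘(ℝ, E) 𝓘(ℝ, E) (extChartAt 𝓘(ℝ, E) p) q v := by
    rintro r rfl v; rfl
  exact key _ (one_smul G q) _

variable [LieGroup 𝓘(ℝ, F) ∞ G]

lemma contDiffAt_actionInChart (p : M) :
    ContDiffAt ℝ ∞ (actionInChart F G p)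
      (extChartAt 𝓘(ℝ, F) (1 : G) 1, extChartAt 𝓘(ℝ, E) p p) := by
  rw [← contMDiffAt_iff_contDiffAt]
  have h1 : ContMDiffAt 𝓘(ℝ, F × E) 𝓘(ℝ, F) ∞
      (fun q : F × E => (extChartAt 𝓘(ℝ, F) (1 : G)).symm q.1)
      (extChartAt 𝓘(ℝ, F) (1 : G) 1, extChartAt 𝓘(ℝ, E) p p) :=
    ContMDiffAt.comp (I' := 𝓘(ℝ, F)) (g := (extChartAt 𝓘(ℝ, F) (1 : G)).symm) (f := Prod.fst) _
      ((contMDiffOn_extChartAt_symm (1 : G)).contMDiffAt (extChartAt_target_mem_nhds (I := 𝓘(ℝ, F)) (1 : G)))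
      contDiff_fst.contMDiff.contMDiffAt
  have h2 : ContMDiffAt 𝓘(ℝ, F × E) 𝓘(ℝ, E) ∞
      (fun q : F × E => (extChartAt 𝓘(ℝ, E) p).symm q.2)
      (extChartAt 𝓘(ℝ, F) (1 : G) 1, extChartAt 𝓘(ℝ, E) p p) :=
    ContMDiffAt.comp (I' := 𝓘(ℝ, E)) (g := (extChartAt 𝓘(ℝ, E) p).symm) (f := Prod.snd) _
      ((contMDiffOn_extChartAt_symm p).contMDiffAt (extChartAt_target_mem_nhds (I := 𝓘(ℝ, E)) p))
      contDiff_snd.contMDiff.contMDiffAt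
  refine ContMDiffAt.comp (I' := 𝓘(ℝ, E)) (g := extChartAt 𝓘(ℝ, E) p) _ ?_ (h1.smul h2)
  change ContMDiffAt 𝓘(ℝ, E) 𝓘(ℝ, E) ∞ (extChartAt 𝓘(ℝ, E) p)
    ((extChartAt 𝓘(ℝ, F) (1 : G)).symm (extChartAt 𝓘(ℝ, F) (1 : G) 1) •
      (extChartAt 𝓘(ℝ, E) p).symm (extChartAt 𝓘(ℝ, E) p p))
  rw [extChartAt_to_inv, extChartAt_to_inv, one_smul]
  exact contMDiffAt_extChartAt

lemma localField_generator (p : M) (x : GroupLieAlgebra 𝓘(ℝ, F) G) {y : E}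
    (hy : y ∈ (extChartAt 𝓘(ℝ, E) p).target) :
    localField (generator E M x) p y =
      -fderiv ℝ (fun a => actionInChart F G p (a, y)) (extChartAt 𝓘(ℝ, F) (1 : G) 1) x := by
  refine Eq.trans ?_ (congrArg Neg.neg (fderiv_actionInChart_left (F := F) (G := G) p hy x)).symm
  exact map_neg (mfderiv 𝓘(ℝ, E) 𝓘(ℝ, E) (extChartAt 𝓘(ℝ, E) p)
    ((extChartAt 𝓘(ℝ, E) p).symm y)) _

/-- The bracket of the Lie algebra of `G` is the commutator, in the chart at `1`, of the
left-invariant vector fields. -/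
lemma bracket_eq_lieBracket_actionInChart
    (u v : GroupLieAlgebra 𝓘(ℝ, F) G) :
    (⁅u, v⁆ : GroupLieAlgebra 𝓘(ℝ, F) G) =
      VectorField.lieBracket ℝ (E := F)
        (fun a => fderiv ℝ (fun b => actionInChart F G (1 : G) (a, b))
          (extChartAt 𝓘(ℝ, F) (1 : G) 1) u)
        (fun a => fderiv ℝ (fun b => actionInChart F G (1 : G) (a, b))
          (extChartAt 𝓘(ℝ, F) (1 : G) 1) v) (extChartAt 𝓘(ℝ, F) (1 : G) 1) := by
  have hfield : ∀ u : GroupLieAlgebra 𝓘(ℝ, F) G,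
      Filter.EventuallyEq (β := F) (𝓝 (extChartAt 𝓘(ℝ, F) (1 : G) 1))
      (VectorField.mpullbackWithin 𝓘(ℝ, F) 𝓘(ℝ, F) (extChartAt 𝓘(ℝ, F) (1 : G)).symm
        (mulInvariantVectorField u) (Set.range 𝓘(ℝ, F)))
      (fun a => fderiv ℝ (fun b => actionInChart F G (1 : G) (a, b))
          (extChartAt 𝓘(ℝ, F) (1 : G) 1) u) := by
    intro u
    filter_upwards [extChartAt_target_mem_nhds (I := 𝓘(ℝ, F)) (1 : G)] with a ha
    set h := (extChartAt 𝓘(ℝ, F) (1 : G)).symm a with hh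
    have hs : h ∈ (extChartAt 𝓘(ℝ, F) (1 : G)).source :=
      (extChartAt 𝓘(ℝ, F) (1 : G)).map_target ha
    have h1 : MDifferentiableAt 𝓘(ℝ, F) 𝓘(ℝ, F) (fun g : G => h * g) 1 :=
      (contMDiff_smul_left F (E := F) h).mdifferentiableAt (by simp)
    have h2 : MDifferentiableAt 𝓘(ℝ, F) 𝓘(ℝ, F) (extChartAt 𝓘(ℝ, F) (1 : G)) (h * 1) := by
      rw [mul_one]; exact mdifferentiableAt_chart 1 hs
    have hinv : (mfderivWithin 𝓘(ℝ, F) 𝓘(ℝ, F) (extChartAt 𝓘(ℝ, F) (1 : G)).symm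
        (Set.range 𝓘(ℝ, F)) a).inverse =
        mfderiv 𝓘(ℝ, F) 𝓘(ℝ, F) (extChartAt 𝓘(ℝ, F) (1 : G)) h :=
      ContinuousLinearMap.inverse_eq (mfderivWithin_extChartAt_symm_comp_mfderiv_extChartAt ha)
        (mfderiv_extChartAt_comp_mfderivWithin_extChartAt_symm ha)
    have key : ∀ r : G, r = h → ∀ v : F,
        (mfderiv 𝓘(ℝ, F) 𝓘(ℝ, F) (extChartAt 𝓘(ℝ, F) (1 : G)) h v : F) =
          mfderiv 𝓘(ℝ, F) 𝓘(ℝ, F) (extChartAt 𝓘(ℝ, F) (1 : G)) r v := by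
      rintro r rfl v; rfl
    refine (DFunLike.congr_fun hinv (mulInvariantVectorField u h)).trans ?_
    refine (key _ (mul_one h) _).trans ?_
    refine (DFunLike.congr_fun (mfderiv_comp (1 : G) h2 h1) u).symm.trans ?_
    exact (fderiv_comp_chart_symm (f := fun g : G => extChartAt 𝓘(ℝ, F) (1 : G) (h * g))
      (h2.comp 1 h1) u).symm
  have h0 := VectorField.mlieBracketWithin_apply (I := 𝓘(ℝ, F)) (s := Set.univ)
    (V := mulInvariantVectorField u) (W := mulInvariantVectorField v) (x₀ := (1 : G))
  rw [Set.preimage_univ, Set.univ_inter] at h0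
  have hi : ∀ v : F, ((mfderiv 𝓘(ℝ, F) 𝓘(ℝ, F) (extChartAt 𝓘(ℝ, F) (1 : G)) 1).inverse v : F) = v :=
    fun v => by
      rw [mfderiv_extChartAt_self]
      exact DFunLike.congr_fun (ContinuousLinearMap.inverse_id (R := ℝ) (M := F)) v
  refine h0.trans ((hi _).trans ?_)
  have hu : ∀ V W : F → F, VectorField.lieBracketWithin ℝ V W (Set.range 𝓘(ℝ, F)) =
      VectorField.lieBracket ℝ V W := fun V W => by
    rw [ModelWithCorners.range_eq_univ, VectorField.lieBracketWithin_univ]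
  exact (congrFun (hu _ _) _).trans ((hfield u).lieBracket_vectorField_eq (hfield v))

end ActionInChart

/-! ### Infinitesimal generators -/
section Generators
variable {E : Type*} [NormedAddCommGroup E] [NormedSpace ℝ E]
variable {M : Type*} [TopologicalSpace M] [ChartedSpace E M] [IsManifold 𝓘(ℝ, E) ∞ M]
variable {F : Type*} [NormedAddCommGroup F] [NormedSpace ℝ F]
variable {G : Type*} [TopologicalSpace G] [ChartedSpace F G] [Group G] [LieGroup 𝓘(ℝ, F) ∞ G]
variable [MulAction G M] [ContMDiffSMul 𝓘(ℝ, F) 𝓘(ℝ, E) ∞ G M]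

lemma localField_generator_eventuallyEq (p : M) (x : GroupLieAlgebra 𝓘(ℝ, F) G) :
    localField (generator E M x) p =ᶠ[𝓝 (extChartAt 𝓘(ℝ, E) p p)]
      fun y => fderiv ℝ (fun a => actionInChart F G p (a, y)) (extChartAt 𝓘(ℝ, F) (1 : G) 1)
        (-x : F) := by
  filter_upwards [extChartAt_target_mem_nhds (I := 𝓘(ℝ, E)) p] with y hy
  exact (localField_generator p x hy).trans (map_neg _ _).symm

lemma evalField_generator (p : M) (x : GroupLieAlgebra 𝓘(ℝ, F) G) :
    evalField (generator E M x) p =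
      fderiv ℝ (fun a => actionInChart F G p (a, extChartAt 𝓘(ℝ, E) p p))
        (extChartAt 𝓘(ℝ, F) (1 : G) 1) (-x : F) := by
  rw [← localField_self]
  exact (localField_generator_eventuallyEq p x).self_of_nhds

/-- With the sign chosen for the generators, `[v_x, v_y] = v_{[x, y]}`. -/
lemma fieldBracket_generator (x y : GroupLieAlgebra 𝓘(ℝ, F) G) (p : M) :
    fieldBracket (generator E M x) (generator E M y) p = evalField (generator E M ⁅x, y⁆) p := by
  have hle : (2 : WithTop ℕ∞) ≤ ∞ := ENat.LEInfty.out
  have h := lieBracket_generating_fields (E := E) (F := F) (Φ := actionInChart F G p)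
    (μ := actionInChart F G (1 : G)) ((contDiffAt_actionInChart (E := E) p).of_le hle)
    ((contDiffAt_actionInChart (E := F) (1 : G)).of_le hle) (actionInChart_one p)
    (by
      filter_upwards [extChartAt_target_mem_nhds (I := 𝓘(ℝ, F)) (1 : G)] with a ha
      change extChartAt 𝓘(ℝ, F) (1 : G) ((extChartAt 𝓘(ℝ, F) (1 : G)).symm a *
        (extChartAt 𝓘(ℝ, F) (1 : G)).symm (extChartAt 𝓘(ℝ, F) (1 : G) 1)) = a
      rw [extChartAt_to_inv, mul_one, (extChartAt 𝓘(ℝ, F) (1 : G)).right_inv ha])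
    (actionInChart_one (1 : G)) (actionInChart_mul p) y x
  have hb := bracket_eq_lieBracket_actionInChart y x
  rw [evalField_generator, fieldBracket,
    (localField_generator_eventuallyEq p x).lieBracket_vectorField_eq
    (localField_generator_eventuallyEq p y)]
  have hxy : (-⁅x, y⁆ : GroupLieAlgebra 𝓘(ℝ, F) G) = ⁅y, x⁆ :=
    (VectorField.mlieBracket_swap_apply (I := 𝓘(ℝ, F)) (V := mulInvariantVectorField y)
      (W := mulInvariantVectorField x)).symm
  refine Eq.trans ?_ (congrArg _ (hxy.trans hb)).symm
  -- the two signs in the definition of the generators cancel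
  have hneg : ∀ (A : E → F →L[ℝ] E) (u v : F) (z : E),
      VectorField.lieBracket ℝ (fun z => A z (-u)) (fun z => A z (-v)) z =
        VectorField.lieBracket ℝ (fun z => A z u) (fun z => A z v) z := by
    intro A u v z
    simp only [map_neg, VectorField.lieBracket, fderiv_fun_neg, neg_apply, neg_neg]
  exact (hneg _ x y _).trans h.symm

/-- The infinitesimal form of invariance: `L_{v_x} σ = 0`. -/
lemma lieDeriv_generator_eq_zero {k : ℕ} {σ : DiffForm E M k} (hσ : IsInvariant G σ)
    (x : GroupLieAlgebra 𝓘(ℝ, F) G) (p : M) (w : Fin k → E) :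
    lieDeriv (generator E M x) σ p w = 0 := by
  have hle : (2 : WithTop ℕ∞) ≤ ∞ := ENat.LEInfty.out
  have hinv : ∀ᶠ a in 𝓝 (extChartAt 𝓘(ℝ, F) (1 : G) 1),
      localForm σ p (actionInChart F G p (a, extChartAt 𝓘(ℝ, E) p p))
        (fun i => fderiv ℝ (fun z => actionInChart F G p (a, z)) (extChartAt 𝓘(ℝ, E) p p) (w i)) =
      localForm σ p (extChartAt 𝓘(ℝ, E) p p) w := by
    filter_upwards [eventually_chart_symm_smul_mem (F := F) (E := E) p] with a ha
    set g := (extChartAt 𝓘(ℝ, F) (1 : G)).symm a with hg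
    have h1 : MDifferentiableAt 𝓘(ℝ, E) 𝓘(ℝ, E) (fun q : M => g • q) p :=
      (contMDiff_smul_left F g).mdifferentiableAt (by simp)
    have h2 : MDifferentiableAt 𝓘(ℝ, E) 𝓘(ℝ, E) (extChartAt 𝓘(ℝ, E) p) (g • p) :=
      mdifferentiableAt_chart p ha
    have hd : ∀ v : E, fderiv ℝ (fun z => actionInChart F G p (a, z)) (extChartAt 𝓘(ℝ, E) p p) v =
        mfderiv 𝓘(ℝ, E) 𝓘(ℝ, E) (extChartAt 𝓘(ℝ, E) p) (g • p)
          (mfderiv 𝓘(ℝ, E) 𝓘(ℝ, E) (fun q : M => g • q) p v) := fun v =>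
      (fderiv_comp_chart_symm (f := fun q : M => extChartAt 𝓘(ℝ, E) p (g • q))
        (h2.comp p h1) v).trans (DFunLike.congr_fun (mfderiv_comp p h2 h1) v)
    have hpt : actionInChart F G p (a, extChartAt 𝓘(ℝ, E) p p) =
        extChartAt 𝓘(ℝ, E) p (g • p) := by
      change extChartAt 𝓘(ℝ, E) p (g • (extChartAt 𝓘(ℝ, E) p).symm (extChartAt 𝓘(ℝ, E) p p)) = _
      rw [extChartAt_to_inv]
    rw [hpt, localForm_self]
    have hinvp : σ.1 (g • p) (fun i => mfderiv 𝓘(ℝ, E) 𝓘(ℝ, E) (fun q : M => g • q) p (w i)) =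
      σ.1 p w := DFunLike.congr_fun (hσ g p) w
    refine Eq.trans ?_ hinvp
    -- the base points agree only propositionally, so the transport is done for a variable `q`
    have key : ∀ (q : M) (A : E →L[ℝ] TangentSpace 𝓘(ℝ, E) q) (u v : Fin k → E), q = g • p →
        (∀ i, (A (u i) : E) = v i) →
        (σ.1 q).compContinuousLinearMap A u = σ.1 (g • p) v := by
      rintro q A u v rfl h
      exact congrArg (σ.1 (g • p)) (funext h)
    refine key _ _ _ _ ((extChartAt 𝓘(ℝ, E) p).left_inv ha) fun i => ?_
    have hid := mfderivWithin_extChartAt_symm_comp_mfderiv_extChartAt' (I := 𝓘(ℝ, E)) ha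
    rw [ModelWithCorners.range_eq_univ, mfderivWithin_univ] at hid
    rw [hd]
    exact DFunLike.congr_fun hid (mfderiv 𝓘(ℝ, E) 𝓘(ℝ, E) (fun q : M => g • q) p (w i))
  have h := lieDerivAt_eq_zero_of_invariant ((contDiffAt_actionInChart p).of_le hle)
    (actionInChart_one (G := G) (F := F) p) (differentiableAt_localForm σ p) w hinv (-x : F)
  rw [lieDeriv, lieDerivAt, (localField_generator_eventuallyEq p x).fderiv_eq,
    (localField_generator_eventuallyEq p x).self_of_nhds]
  exact h

end Generators

/-! ### Cartan's formula for the Chevalley–Eilenberg differential -/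
section ChevalleyEilenbergCartan

lemma sum_Ici_eq_sum_ite {A : Type*} [AddCommMonoid A] {k : ℕ} (i : Fin k) (f : Fin k → A) :
    ∑ j ≥ i, f j = ∑ j, if i ≤ j then f j else 0 := by
  rw [← Finset.sum_filter]
  exact Finset.sum_congr (by ext; simp) fun _ _ => rfl

variable {L : Type*} [LieRing L] [LieAlgebra ℝ L] {W : Type*} [AddCommGroup W] [Module ℝ W]

lemma ceD_apply {k : ℕ} (φ : L [⋀^Fin (k + 1)]→ₗ[ℝ] W) (x : Fin (k + 2) → L) :
    ceD k φ x = ∑ i : Fin (k + 1), ∑ j ≥ i, (-1 : ℝ) ^ ((i : ℕ) + j + 1) •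
      φ (Matrix.vecCons ⁅x i.castSucc, x j.succ⁆ (j.removeNth (i.castSucc.removeNth x))) := rfl

lemma smul_apply_vecCons_removeNth {k : ℕ} (φ : L [⋀^Fin (k + 1)]→ₗ[ℝ] W) (x : Fin (k + 1) → L)
    (j : Fin (k + 1)) (a : L) :
    (-1 : ℝ) ^ (j : ℕ) • φ (Matrix.vecCons a (j.removeNth x)) = φ (Function.update x j a) := by
  have h := φ.map_insertNth j a (j.removeNth x)
  rw [Fin.insertNth_removeNth] at h
  rw [h, ← Int.cast_smul_eq_zsmul ℝ]
  push_cast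
  rfl

lemma apply_vecCons_vecCons_swap {k : ℕ} (φ : L [⋀^Fin (k + 2)]→ₗ[ℝ] W) (a b : L)
    (x : Fin k → L) :
    φ (Matrix.vecCons a (Matrix.vecCons b x)) = -φ (Matrix.vecCons b (Matrix.vecCons a x)) := by
  have h := φ.map_insertNth 1 b (Matrix.vecCons a x)
  have he : Fin.insertNth (α := fun _ => L) 1 b (Matrix.vecCons a x) =
      Matrix.vecCons a (Matrix.vecCons b x) := by
    rw [eq_comm, Fin.eq_insertNth_iff]
    refine ⟨rfl, funext fun i => ?_⟩
    refine Fin.cases rfl (fun i => ?_) i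
    have : (1 : Fin (k + 2)).succAbove i.succ = i.succ.succ :=
      Fin.succAbove_of_le_castSucc _ _ (by simp [Fin.le_def])
    simp [Fin.removeNth, this]
  rw [he] at h
  rw [h]
  simp

lemma removeNth_succ_cons {X : Type*} {k : ℕ} (i : Fin (k + 1)) (a : X) (x : Fin (k + 1) → X) :
    i.succ.removeNth (Matrix.vecCons a x) = Matrix.vecCons a (i.removeNth x) := by
  funext j
  refine Fin.cases ?_ (fun j => ?_) j <;> simp [Fin.removeNth, Matrix.vecCons]

lemma ceD_zero_cons (φ : L [⋀^Fin 1]→ₗ[ℝ] W) (a : L) (x : Fin 1 → L) :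
    ceD 0 φ (Matrix.vecCons a x) = -∑ i, φ (Function.update x i ⁅a, x i⁆) := by
  rw [ceD_apply]
  simp only [← smul_apply_vecCons_removeNth]
  simp [sum_Ici_eq_sum_ite]

/-- Cartan's formula: contracting `d_𝔤 φ` with `a` gives the (trivial-coefficient) Lie derivative
of `φ` along `a`, minus `d_𝔤` of the contraction of `φ` with `a`. -/
lemma ceD_succ_cons {k : ℕ} (φ : L [⋀^Fin (k + 2)]→ₗ[ℝ] W) (a : L) (x : Fin (k + 2) → L) :
    ceD (k + 1) φ (Matrix.vecCons a x) =
      -∑ i, φ (Function.update x i ⁅a, x i⁆) - ceD k (φ.curryLeft a) x := by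
  rw [ceD_apply, Fin.sum_univ_succ, sub_eq_add_neg]
  congr 1
  · simp only [← smul_apply_vecCons_removeNth, ← Finset.sum_neg_distrib]
    rw [sum_Ici_eq_sum_ite]
    refine Finset.sum_congr rfl fun j _ => ?_
    rw [if_pos (Fin.zero_le j)]
    have : (Fin.castSucc (0 : Fin (k + 2))).removeNth (Matrix.vecCons a x) = x := rfl
    rw [this]
    simp [pow_succ]
  · rw [ceD_apply, ← Finset.sum_neg_distrib]
    refine Finset.sum_congr rfl fun i _ => ?_
    rw [sum_Ici_eq_sum_ite, sum_Ici_eq_sum_ite, Fin.sum_univ_succ, ← Finset.sum_neg_distrib]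
    simp only [Fin.succ_le_succ_iff]
    rw [if_neg (by simp), zero_add]
    refine Finset.sum_congr rfl fun j _ => ?_
    split_ifs with hij
    · have e1 : i.succ.castSucc = i.castSucc.succ := rfl
      rw [e1, removeNth_succ_cons, removeNth_succ_cons, apply_vecCons_vecCons_swap]
      simp only [Matrix.cons_val_succ, Fin.val_succ, AlternatingMap.curryLeft_apply_apply]
      rw [smul_neg]
      congr 2
      ring
    · simp

lemma ceD_compAlternatingMap {W' : Type*} [AddCommGroup W'] [Module ℝ W'] {k : ℕ} (g : W →ₗ[ℝ] W')
    (φ : L [⋀^Fin (k + 1)]→ₗ[ℝ] W) (x : Fin (k + 2) → L) :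
    ceD k (g.compAlternatingMap φ) x = g (ceD k φ x) := by
  simp only [ceD_apply, map_sum, map_smul, LinearMap.compAlternatingMap_apply]

end ChevalleyEilenbergCartan

/-! ### Contractions with generators -/
section ContractGen
variable {E : Type*} [NormedAddCommGroup E] [NormedSpace ℝ E]
variable {M : Type*} [TopologicalSpace M] [ChartedSpace E M] [IsManifold 𝓘(ℝ, E) ∞ M]

lemma append_cons_eq_insertNth {X : Type*} (l k : ℕ) (v : X) (V : Fin k → X) (w : Fin l → X)
    (h : l + k + 1 = k + (l + 1)) :
    Fin.append V (Fin.cons v w : Fin (l + 1) → X) ∘ Fin.cast h =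
      Fin.insertNth (α := fun _ => X) (⟨k, by omega⟩ : Fin (l + k + 1)) v
        (Fin.append V w ∘ Fin.cast (Nat.add_comm l k)) := by
  rw [Fin.eq_insertNth_iff]
  constructor
  · have : Fin.cast h ⟨k, by omega⟩ = Fin.natAdd k (0 : Fin (l + 1)) := by ext; simp
    simp only [Function.comp_apply, this, Fin.append_right, Fin.cons_zero]
  · funext i
    obtain ⟨j, rfl⟩ : ∃ j, i = Fin.cast (Nat.add_comm k l) j :=
      ⟨Fin.cast (Nat.add_comm l k) i, rfl⟩
    refine Fin.addCases (fun b => ?_) (fun b => ?_) j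
    · have : Fin.cast h ((⟨k, by omega⟩ : Fin (l + k + 1)).succAbove
          (Fin.cast (Nat.add_comm k l) (Fin.castAdd l b))) = Fin.castAdd (l + 1) b := by
        rw [Fin.succAbove_of_castSucc_lt _ _ (by simp [Fin.lt_def])]
        ext; simp
      simp [Fin.removeNth, this]
    · have : Fin.cast h ((⟨k, by omega⟩ : Fin (l + k + 1)).succAbove
          (Fin.cast (Nat.add_comm k l) (Fin.natAdd k b))) = Fin.natAdd k b.succ := by
        rw [Fin.succAbove_of_le_castSucc _ _ (by simp [Fin.le_def])]
        ext; simp; omega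
      change Fin.append V _ (Fin.cast h _) = Fin.append V w (Fin.natAdd k b)
      rw [this, Fin.append_right, Fin.append_right, Fin.cons_succ]

/-- The vector field contracted first can be contracted last, at the cost of the sign `(-1)^k`. -/
lemma contract_cons {k l N : ℕ} (h : l + 1 + k = N) (h' : l + (k + 1) = N) (v : VecField E M)
    (V : Fin k → VecField E M) (σ : DiffForm E M N) :
    contract h' (Fin.cons v V : Fin (k + 1) → VecField E M) σ =
      (-1 : ℝ) ^ k • interiorProd l v (contract h V σ) := by
  subst h'
  refine evalForm_ext fun p w => ?_
  rw [evalForm_smul, evalForm_interiorProd, evalForm_contract, evalForm_contract]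
  have e1 : (fun i => evalField ((Fin.cons v V : Fin (k + 1) → VecField E M) i) p) =
      Fin.cons (evalField v p) (fun i => evalField (V i) p) := by
    funext i; refine Fin.cases ?_ (fun i => ?_) i <;> rfl
  rw [e1]
  have e2 := cons_append_tail l k (Fin.cons (evalField v p) (fun i => evalField (V i) p)) w
  rw [Fin.tail_cons, Fin.cons_zero] at e2
  have e3 := append_cons_eq_insertNth l k (evalField v p) (fun i => evalField (V i) p) w (by omega)
  refine (congrArg (evalForm σ p) e2.symm).trans ?_
  refine Eq.trans ?_ (congrArg (fun t => (-1 : ℝ) ^ k * evalForm σ p t) e3.symm)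
  have e4 := ContinuousAlternatingMap.map_insertNth (n := l + k) (valueForm σ p) ⟨k, by omega⟩
    (evalField v p) (Fin.append (fun i => evalField (V i) p) w ∘ Fin.cast (Nat.add_comm l k))
  simp only [evalForm_eq]
  rw [e4]
  simp only [zsmul_eq_mul]
  push_cast
  rw [← mul_assoc, ← pow_add, Even.neg_one_pow ⟨k, rfl⟩, one_mul]
  rfl

variable {F : Type*} [NormedAddCommGroup F] [NormedSpace ℝ F]
variable {G : Type*} [TopologicalSpace G] [ChartedSpace F G] [Group G] [LieGroup 𝓘(ℝ, F) ∞ G]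
variable [MulAction G M] [ContMDiffSMul 𝓘(ℝ, F) 𝓘(ℝ, E) ∞ G M]

lemma contractGen_apply {k l N : ℕ} (h : l + k = N) (σ : DiffForm E M N)
    (x : Fin k → GroupLieAlgebra 𝓘(ℝ, F) G) :
    contractGen F G h σ x = contract h (fun i => generator E M (x i)) σ := rfl

lemma contractGen_cons {k l N : ℕ} (h : l + 1 + k = N) (h' : l + (k + 1) = N)
    (σ : DiffForm E M N) (a : GroupLieAlgebra 𝓘(ℝ, F) G) (x : Fin k → GroupLieAlgebra 𝓘(ℝ, F) G) :
    contractGen F G h' σ (Matrix.vecCons a x) =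
      (-1 : ℝ) ^ k • interiorProd l (generator E M a) (contractGen F G h σ x) := by
  rw [contractGen_apply, contractGen_apply, ← contract_cons h h']
  congr 1
  funext i
  refine Fin.cases ?_ (fun i => ?_) i <;> rfl

lemma extD_interiorProd_generator {l : ℕ} {σ : DiffForm E M (l + 1)} (hclosed : extD (l + 1) σ = 0)
    (hinv : IsInvariant G σ) (x : GroupLieAlgebra 𝓘(ℝ, F) G) :
    extD l (interiorProd l (generator E M x) σ) = 0 := by
  refine evalForm_ext fun p w => ?_
  have h := lieDeriv_eq_cartan (generator E M x) σ p w
  rw [lieDeriv_generator_eq_zero hinv, hclosed, map_zero, evalForm_zero, add_zero] at h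
  exact h.symm

lemma lieDeriv_contractGen {k l N : ℕ} (h : l + k = N) {σ : DiffForm E M N}
    (hinv : IsInvariant G σ) (a : GroupLieAlgebra 𝓘(ℝ, F) G)
    (x : Fin k → GroupLieAlgebra 𝓘(ℝ, F) G) (p : M) (w : Fin l → E) :
    lieDeriv (generator E M a) (contractGen F G h σ x) p w =
      evalForm (∑ i, contractGen F G h σ (Function.update x i ⁅a, x i⁆)) p w := by
  rw [contractGen_apply, lieDeriv_contract, lieDeriv_generator_eq_zero hinv, zero_add, evalForm_sum]
  refine Finset.sum_congr rfl fun i _ => ?_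
  rw [contractGen_apply, evalForm_contract, fieldBracket_generator]
  have : (fun j => evalField (generator E M (Function.update x i ⁅a, x i⁆ j)) p) =
      Function.update (fun j => evalField (generator E M (x j)) p) i
        (evalField (generator E M ⁅a, x i⁆) p) :=
    generator_update x i ⁅a, x i⁆ p
  rw [this]

variable [CompleteSpace F]

/-- Passage from Cartan's formula for `d_𝔤 σ_{k+1}` to `d_𝔤 σ_{k+1} = ± d σ_{k+2}`. -/
lemma ceD_contractGen_of_cartan {k l N : ℕ} {σ : DiffForm E M N} (h : l + 1 + (k + 1) = N)
    (h' : l + (k + 2) = N)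
    (hcartan : ∀ (a : GroupLieAlgebra 𝓘(ℝ, F) G) (x : Fin (k + 1) → GroupLieAlgebra 𝓘(ℝ, F) G)
      (p : M) (w : Fin (l + 1) → E),
      evalForm (ceD k (contractGen F G h σ) (Matrix.vecCons a x)) p w =
        -lieDeriv (generator E M a) (contractGen F G h σ x) p w +
          evalForm (interiorProd (l + 1) (generator E M a)
            (extD (l + 1) (contractGen F G h σ x))) p w)
    (x : Fin (k + 2) → GroupLieAlgebra 𝓘(ℝ, F) G) :
    ceD k (contractGen F G h σ) x = (-1 : ℝ) ^ k • extD l (contractGen F G h' σ x) := by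
  obtain ⟨a, y, rfl⟩ : ∃ a y, x = Matrix.vecCons a y := ⟨_, _, (Matrix.cons_head_tail x).symm⟩
  rw [contractGen_cons h h', map_smul, smul_smul, ← pow_add]
  refine evalForm_ext fun p w => ?_
  rw [hcartan, lieDeriv_eq_cartan, evalForm_smul,
    Odd.neg_one_pow (⟨k, by ring⟩ : Odd (k + (k + 1)))]
  ring

/-- Cartan's formula `ι_a d_𝔤 σ_{k+1} = -L_{v_a} σ_{k+1} + ι_{v_a} d σ_{k+1}`. -/
lemma evalForm_ceD_contractGen {N : ℕ} {σ : DiffForm E M N} (hclosed : extD N σ = 0)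
    (hinv : IsInvariant G σ) (k : ℕ) : ∀ (l : ℕ) (h : l + (k + 1) = N)
    (a : GroupLieAlgebra 𝓘(ℝ, F) G) (x : Fin (k + 1) → GroupLieAlgebra 𝓘(ℝ, F) G) (p : M)
    (w : Fin l → E),
    evalForm (ceD k (contractGen F G h σ) (Matrix.vecCons a x)) p w =
      -lieDeriv (generator E M a) (contractGen F G h σ x) p w +
        evalForm (interiorProd l (generator E M a) (extD l (contractGen F G h σ x))) p w := by
  induction k with
  | zero =>
    intro l h a x p w
    have hd : extD l (contractGen F G h σ x) = 0 := by
      subst h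
      exact extD_interiorProd_generator hclosed hinv (x 0)
    rw [ceD_zero_cons, lieDeriv_contractGen h hinv, hd, map_zero, evalForm_zero, add_zero]
    rfl
  | succ k ih =>
    intro l h a x p w
    have h1 : l + 1 + (k + 1) = N := by omega
    have hcurry : (contractGen F G h σ).curryLeft a = (-1 : ℝ) ^ (k + 1) •
        (interiorProd l (generator E M a)).compAlternatingMap (contractGen F G h1 σ) := by
      ext1 y
      exact contractGen_cons h1 h σ a y
    rw [ceD_succ_cons, lieDeriv_contractGen h hinv, hcurry, map_smul, AlternatingMap.smul_apply,
      ceD_compAlternatingMap, ceD_contractGen_of_cartan h1 h (ih (l + 1) h1), map_smul, smul_smul,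
      ← pow_add, Odd.neg_one_pow (⟨k, by ring⟩ : Odd (k + 1 + k)), neg_one_smul, sub_neg_eq_add,
      evalForm_add]
    rfl

/-- `d_𝔤 σ_{k+1} = (-1)^k d σ_{k+2}`, for the contractions `σ_r` of a closed invariant form. -/
lemma ceD_contractGen {k l N : ℕ} {σ : DiffForm E M N} (hclosed : extD N σ = 0)
    (hinv : IsInvariant G σ) (h : l + 1 + (k + 1) = N) (h' : l + (k + 2) = N)
    (x : Fin (k + 2) → GroupLieAlgebra 𝓘(ℝ, F) G) :
    ceD k (contractGen F G h σ) x = (-1 : ℝ) ^ k • extD l (contractGen F G h' σ x) :=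
  ceD_contractGen_of_cartan h h' (evalForm_ceD_contractGen hclosed hinv k (l + 1) h) x

/-- In top degree, where `σ_{k+1}` takes values in functions, `d_𝔤 σ_{k+1} = 0`. -/
lemma ceD_contractGen_top {k N : ℕ} {σ : DiffForm E M N} (hclosed : extD N σ = 0)
    (hinv : IsInvariant G σ) (h : 0 + (k + 1) = N) :
    ceD k (contractGen F G h σ) = 0 := by
  ext1 x
  obtain ⟨a, y, rfl⟩ : ∃ a y, x = Matrix.vecCons a y := ⟨_, _, (Matrix.cons_head_tail x).symm⟩
  refine evalForm_ext fun p w => ?_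
  rw [evalForm_ceD_contractGen hclosed hinv, lieDeriv_zero_form, neg_add_cancel]
  rfl

end ContractGen

/-! ### Primitives and moment maps -/
section Signs

lemma varsigma_mul_self (k : ℕ) : varsigma k * varsigma k = 1 := by
  rw [varsigma, neg_mul_neg, ← pow_add, Even.neg_one_pow ⟨_, rfl⟩]

lemma varsigma_one : varsigma 1 = 1 := by norm_num [varsigma]

lemma varsigma_succ (k : ℕ) : varsigma (k + 1) = (-1) ^ (k + 1) * varsigma k := by
  have h : (k + 1) * (k + 1 + 1) / 2 = (k + 1) + k * (k + 1) / 2 := by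
    rw [show (k + 1) * (k + 1 + 1) = k * (k + 1) + (k + 1) * 2 by ring,
      Nat.add_mul_div_right _ _ (by norm_num)]
    ring
  rw [varsigma, varsigma, h, pow_add]
  ring

/-- The relation of an `L∞`-morphism between consecutive components, up to the signs `ς`, is the
equation for a primitive of `σ̃`. -/
lemma varsigma_relation_iff {W : Type*} [AddCommGroup W] [Module ℝ W] (k : ℕ) (a b c : W) :
    -(varsigma (k + 1) • a) = varsigma (k + 2) • b + varsigma (k + 2) • c ↔
      a + (-1 : ℝ) ^ (k + 2) • b = (-1 : ℝ) ^ (k + 1) • c := by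
  have hs : varsigma (k + 2) = (-1) ^ k * varsigma (k + 1) := by
    rw [varsigma_succ, pow_succ, pow_succ]; ring
  have hne : varsigma (k + 1) ≠ 0 := fun h => by
    have := varsigma_mul_self (k + 1); simp [h] at this
  have hp : (-1 : ℝ) ^ (k + 2) = (-1) ^ k := by rw [pow_add]; norm_num
  rw [hs, hp, pow_succ]
  have h1 : -(varsigma (k + 1) • a) = ((-1) ^ k * varsigma (k + 1)) • b +
      ((-1) ^ k * varsigma (k + 1)) • c ↔
      varsigma (k + 1) • (a + (-1 : ℝ) ^ k • b - ((-1) ^ k * -1 : ℝ) • c) = 0 := by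
    rw [← sub_eq_zero, ← neg_eq_zero]
    have : -(-(varsigma (k + 1) • a) - (((-1) ^ k * varsigma (k + 1)) • b +
      ((-1) ^ k * varsigma (k + 1)) • c)) =
      varsigma (k + 1) • (a + (-1 : ℝ) ^ k • b - ((-1) ^ k * -1 : ℝ) • c) := by
      module
    rw [this]
  rw [h1, smul_eq_zero, or_iff_right hne, sub_eq_zero]

end Signs

section Primitives
variable {E : Type*} [NormedAddCommGroup E] [NormedSpace ℝ E]
variable {M : Type*} [TopologicalSpace M] [ChartedSpace E M]
variable {F : Type*} [NormedAddCommGroup F] [NormedSpace ℝ F]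
variable {G : Type*} [TopologicalSpace G] [ChartedSpace F G] [Group G]

lemma signTwist_signTwist {n : ℕ} (φ : TotalComplex E M F G n) :
    signTwist n (signTwist n φ) = φ := by
  funext q
  change varsigma (q.k + 1) • varsigma (q.k + 1) • φ q = φ q
  rw [smul_smul, varsigma_mul_self, one_smul]

lemma sum_smul_eq_neg_ceD {L : Type*} [LieRing L] [LieAlgebra ℝ L] {W : Type*} [AddCommGroup W]
    [Module ℝ W] {k : ℕ} (c : ℝ) (φ : L [⋀^Fin (k + 1)]→ₗ[ℝ] W) (x : Fin (k + 2) → L) :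
    ∑ i : Fin (k + 1), ∑ j ≥ i, (-1 : ℝ) ^ ((i : ℕ) + j) • (c • φ)
      (Matrix.vecCons ⁅x i.castSucc, x j.succ⁆ (j.removeNth (i.castSucc.removeNth x))) =
      -(c • ceD k φ x) := by
  simp only [ceD_apply, Finset.smul_sum, ← Finset.sum_neg_distrib]
  refine Finset.sum_congr rfl fun i _ => Finset.sum_congr rfl fun j _ => ?_
  rw [AlternatingMap.smul_apply, pow_succ]
  module

variable [IsManifold 𝓘(ℝ, E) ∞ M] [CompleteSpace F] [LieGroup 𝓘(ℝ, F) ∞ G]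
variable [MulAction G M] [ContMDiffSMul 𝓘(ℝ, F) 𝓘(ℝ, E) ∞ G M]

theorem dTot_tilde {n : ℕ} {σ : DiffForm E M (n + 1)} (hclosed : extD (n + 1) σ = 0)
    (hinv : IsInvariant G σ) : dTot (n + 1) (tilde F G σ) = 0 := by
  funext ⟨k, l, h⟩
  change cePart (tilde F G σ) k l h + (-1 : ℝ) ^ (k + 1) • deRhamPart (tilde F G σ) k l h = 0
  match k, l, h with
  | 0, 0, h => omega
  | 0, l + 1, h =>
    obtain rfl : l = n := by omega
    ext1 x
    have hd : extD l (contractGen F G rfl σ x) = 0 := extD_interiorProd_generator hclosed hinv (x 0)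
    change 0 + (-1 : ℝ) ^ (0 + 1) • extD l ((-1 : ℝ) ^ 0 • contractGen F G _ σ x) = 0
    rw [map_smul, hd, smul_zero, smul_zero, add_zero]
  | k + 1, 0, h =>
    change ceD k ((-1 : ℝ) ^ k • contractGen F G _ σ) + (-1 : ℝ) ^ (k + 1 + 1) • 0 = 0
    rw [map_smul, ceD_contractGen_top hclosed hinv, smul_zero, smul_zero, add_zero]
  | k + 1, l + 1, h =>
    change ceD k ((-1 : ℝ) ^ k • contractGen F G _ σ) + (-1 : ℝ) ^ (k + 1 + 1) •
      (extD l).compAlternatingMap ((-1 : ℝ) ^ (k + 1) • contractGen F G _ σ) = 0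
    ext1 x
    rw [map_smul, AlternatingMap.add_apply, AlternatingMap.smul_apply, AlternatingMap.smul_apply,
      LinearMap.compAlternatingMap_apply, AlternatingMap.smul_apply, map_smul,
      ceD_contractGen hclosed hinv _ (by omega), smul_smul, smul_smul, ← add_smul,
      pow_succ, pow_succ]
    have : (-1 : ℝ) ^ k * (-1) ^ k + (-1) ^ k * -1 * -1 * ((-1) ^ k * -1) = 0 := by ring
    rw [this, zero_smul]
    rfl

theorem dTot_eq_tilde_iff {n : ℕ} (hn : 1 ≤ n) (σ : DiffForm E M (n + 1))
    (φ : TotalComplex E M F G n) :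
    dTot n φ = tilde F G σ ↔ IsHomotopyMomentMap σ (signTwist n φ) := by
  -- the equations in the bidegrees `(1, n)`, `(k + 2, l + 1)` and `(n + 1, 0)`
  have e0 : ∀ (l : ℕ) (h : 0 + 1 + (l + 1) = n + 1),
      dTot n φ ⟨0, l + 1, h⟩ = tilde F G σ ⟨0, l + 1, h⟩ ↔
        ∀ x, extD l (φ ⟨0, l, by omega⟩ x) =
          -contractGen F G (show l + 1 + (0 + 1) = n + 1 by omega) σ x := by
    intro l h
    have hsign : ∀ a b : DiffForm E M (l + 1),
        0 + (-1 : ℝ) ^ (0 + 1) • a = (-1 : ℝ) ^ 0 • b ↔ a = -b := fun a b => by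
      rw [zero_add, zero_add, pow_one, pow_zero, one_smul, neg_one_smul, neg_eq_iff_eq_neg]
    exact AlternatingMap.ext_iff.trans (forall_congr' fun x => hsign _ _)
  have e1 : ∀ (k l : ℕ) (h : k + 1 + 1 + (l + 1) = n + 1),
      dTot n φ ⟨k + 1, l + 1, h⟩ = tilde F G σ ⟨k + 1, l + 1, h⟩ ↔
        ∀ x, ceD k (φ ⟨k, l + 1, by omega⟩) x +
          (-1 : ℝ) ^ (k + 2) • extD l (φ ⟨k + 1, l, by omega⟩ x) =
            (-1 : ℝ) ^ (k + 1) • contractGen F G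
              (show l + 1 + (k + 1 + 1) = n + 1 by omega) σ x := by
    intro k l h
    exact AlternatingMap.ext_iff
  have e2 : ∀ (k : ℕ) (h : k + 1 + 1 + 0 = n + 1),
      dTot n φ ⟨k + 1, 0, h⟩ = tilde F G σ ⟨k + 1, 0, h⟩ ↔
        ∀ x, ceD k (φ ⟨k, 0, by omega⟩) x + (-1 : ℝ) ^ (k + 2) • (0 : DiffForm E M 0) =
            (-1 : ℝ) ^ (k + 1) • contractGen F G
              (show 0 + (k + 1 + 1) = n + 1 by omega) σ x := by
    intro k h
    exact AlternatingMap.ext_iff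
  have hgen : ∀ x : GroupLieAlgebra 𝓘(ℝ, F) G,
      (fun i : Fin 1 => generator E M ((![x] : Fin 1 → GroupLieAlgebra 𝓘(ℝ, F) G) i)) =
        ![generator E M x] := fun x => by
    funext i; fin_cases i; rfl
  have hone : ∀ (l : ℕ) (h : 0 + 1 + l = n), signTwist n φ ⟨0, l, h⟩ = φ ⟨0, l, h⟩ := fun l h => by
    change varsigma (0 + 1) • φ ⟨0, l, h⟩ = φ ⟨0, l, h⟩
    exact (congrArg (· • φ ⟨0, l, h⟩) varsigma_one).trans (one_smul ℝ _)
  constructor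
  · intro heq
    have hmom : ∀ (l : ℕ) (h : 0 + 1 + l = n) (x : GroupLieAlgebra 𝓘(ℝ, F) G),
        extD l (signTwist n φ ⟨0, l, h⟩ ![x]) =
          -contract (by omega : (l + 1) + 1 = n + 1) ![generator E M x] σ := by
      intro l h x
      rw [hone, (e0 l (by omega)).1 (congrFun heq _) ![x], contractGen_apply, hgen]
    refine ⟨⟨fun l h x => ⟨generator E M x, hmom l h x⟩, fun k l h x => ?_, fun k h x => ?_⟩, hmom⟩
    · refine (sum_smul_eq_neg_ceD (L := GroupLieAlgebra 𝓘(ℝ, F) G) (varsigma (k + 1))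
        (φ ⟨k, l + 1, by omega⟩) x).trans ?_
      refine ((varsigma_relation_iff k _ _ _).2
        ((e1 k l (by omega)).1 (congrFun heq _) x)).trans ?_
      rw [← map_smul]
      rfl
    · subst h
      refine (sum_smul_eq_neg_ceD (L := GroupLieAlgebra 𝓘(ℝ, F) G) (varsigma (k + 1))
        (φ ⟨k, 0, by omega⟩) x).trans ?_
      refine ((varsigma_relation_iff k _ _ _).2
        ((e2 k (by omega)).1 (congrFun heq _) x)).trans ?_
      rw [smul_zero, zero_add]
      rfl
  · intro hf
    funext ⟨k, l, h⟩
    match k, l, h with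
    | 0, 0, h => omega
    | 0, l + 1, h =>
      refine (e0 l h).2 fun x => ?_
      obtain ⟨y, rfl⟩ : ∃ y, x = ![y] := ⟨x 0, by funext i; fin_cases i; rfl⟩
      rw [← hone, hf.moment, contractGen_apply, hgen]
    | k + 1, l + 1, h =>
      refine (e1 k l h).2 fun x => (varsigma_relation_iff k _ _ _).1 ?_
      refine (sum_smul_eq_neg_ceD (L := GroupLieAlgebra 𝓘(ℝ, F) G) (varsigma (k + 1))
        (φ ⟨k, l + 1, by omega⟩) x).symm.trans ((hf.main k l (by omega) x).trans ?_)
      rw [← map_smul]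
      rfl
    | k + 1, 0, h =>
      obtain rfl : k + 1 = n := by omega
      refine (e2 k h).2 fun x => (varsigma_relation_iff k _ _ _).1 ?_
      refine (sum_smul_eq_neg_ceD (L := GroupLieAlgebra 𝓘(ℝ, F) G) (varsigma (k + 1))
        (φ ⟨k, 0, by omega⟩) x).symm.trans ((hf.last k rfl x).trans ?_)
      rw [smul_zero]
      exact (zero_add _).symm

end Primitives

/-! ### Fibres of linear maps as affine subspaces -/

/-- The fibre of a linear map over a point, as an affine subspace. -/
def fiberAffineSubspace {V W : Type*} [AddCommGroup V] [Module ℝ V] [AddCommGroup W] [Module ℝ W]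
    (f : V →ₗ[ℝ] W) (w : W) : AffineSubspace ℝ V where
  carrier := {v | f v = w}
  smul_vsub_vadd_mem' c p₁ p₂ p₃ h₁ h₂ h₃ := by
    change f (c • (p₁ - p₂) + p₃) = w
    rw [map_add, map_smul, map_sub, show f p₁ = w from h₁, show f p₂ = w from h₂, sub_self,
      smul_zero, zero_add]
    exact h₃

lemma mem_fiberAffineSubspace {V W : Type*} [AddCommGroup V] [Module ℝ V] [AddCommGroup W]
    [Module ℝ W] {f : V →ₗ[ℝ] W} {w : W} {v : V} : v ∈ fiberAffineSubspace f w ↔ f v = w := Iff.rfl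

lemma direction_fiberAffineSubspace {V W : Type*} [AddCommGroup V] [Module ℝ V] [AddCommGroup W]
    [Module ℝ W] {f : V →ₗ[ℝ] W} {w : W} {v₀ : V} (h : v₀ ∈ fiberAffineSubspace f w) :
    (fiberAffineSubspace f w).direction = LinearMap.ker f := by
  ext v
  rw [← AffineSubspace.vadd_mem_iff_mem_direction v h, mem_fiberAffineSubspace, vadd_eq_add,
    map_add, mem_fiberAffineSubspace.1 h, LinearMap.mem_ker, add_eq_right]

end
end HomotopyMoment

theorem mainTheorem1 {m d n : ℕ} (hn : 1 ≤ n)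
    {M : Type*} [TopologicalSpace M] [ChartedSpace (EuclideanSpace ℝ (Fin m)) M]
    [IsManifold (𝓡 m) ∞ M]
    {G : Type*} [TopologicalSpace G] [ChartedSpace (EuclideanSpace ℝ (Fin d)) G] [Group G]
    [LieGroup (𝓡 d) ∞ G] [MulAction G M] [ContMDiffSMul (𝓡 d) (𝓡 m) ∞ G M]
    (σ : DiffForm (EuclideanSpace ℝ (Fin m)) M (n + 1))
    (hclosed : extD (n + 1) σ = 0)
    (hinv : IsInvariant G σ) :
    -- `σ̃` is a cocycle of the total complex
    dTot (n + 1)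
      (tilde (EuclideanSpace ℝ (Fin d)) G σ) = 0 ∧
    -- `φ` is a primitive of `σ̃` iff the `ς(k) φ_k` are the components of a moment map
    (∀ φ : TotalComplex (EuclideanSpace ℝ (Fin m)) M
        (EuclideanSpace ℝ (Fin d)) G n,
      dTot n φ = tilde (EuclideanSpace ℝ (Fin d)) G σ ↔
        IsHomotopyMomentMap σ (signTwist n φ)) ∧
    -- this is a bijection between primitives and moment maps
    Set.BijOn (signTwist n)
      {φ : TotalComplex (EuclideanSpace ℝ (Fin m)) M
          (EuclideanSpace ℝ (Fin d)) G n |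
        dTot n φ = tilde (EuclideanSpace ℝ (Fin d)) G σ}
      {f | IsHomotopyMomentMap σ f} ∧
    -- primitives and moment maps form (possibly empty) corresponding affine spaces
    ∃ P A : AffineSubspace ℝ (TotalComplex (EuclideanSpace ℝ (Fin m)) M
        (EuclideanSpace ℝ (Fin d)) G n),
      (∀ φ, φ ∈ P ↔ dTot n φ = tilde (EuclideanSpace ℝ (Fin d)) G σ) ∧
      (∀ f, f ∈ A ↔ IsHomotopyMomentMap σ f) ∧
      A = P.map (signTwist n).toAffineMap ∧
      ((∃ φ, φ ∈ P) → P.direction = LinearMap.ker (dTot n)) 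
:= by
  have hiff := fun φ : TotalComplex (EuclideanSpace ℝ (Fin m)) M (EuclideanSpace ℝ (Fin d)) G n =>
    dTot_eq_tilde_iff hn σ φ
  refine ⟨dTot_tilde hclosed hinv, hiff, ⟨fun φ hφ => (hiff φ).1 hφ, ?_, ?_⟩,
    fiberAffineSubspace (dTot n) (tilde (EuclideanSpace ℝ (Fin d)) G σ), _,
    fun φ => mem_fiberAffineSubspace, fun f => ?_, rfl,
    fun ⟨φ, hφ⟩ => direction_fiberAffineSubspace hφ⟩
  · exact (Function.LeftInverse.injective signTwist_signTwist).injOn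
  · intro f hf
    refine ⟨signTwist n f, (hiff _).2 ?_, signTwist_signTwist f⟩
    rw [signTwist_signTwist]
    exact hf
  · rw [AffineSubspace.mem_map]
    constructor
    · rintro ⟨φ, hφ, rfl⟩
      exact (hiff φ).1 hφ
    · intro hf
      refine ⟨signTwist n f, (hiff _).2 ?_, signTwist_signTwist f⟩
      rw [signTwist_signTwist]
      exact hf
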